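/- Let $(X,\Sigma,\mu)$ be a $\sigma$-finite measure space and let $\mathcal A\subseteq\Sigma$ be a $\sigma$-subalgebra such that $(X,\mathcal A,\mu|_{\mathcal A})$ is $\sigma$-finite. Let $E=E^{\mathcal A}$ denote the conditional expectation with respect to $\mathcal A$; it is defined for $[0,\infty]$-valued measurable functions, and, by $E(f)=E((\operatorname{Re} f)^+)-E((\operatorname{Re} f)^-)+i\,E((\operatorname{Im} f)^+)-i\,E((\operatorname{Im} f)^-)$, for every conditionable function $f$, that is, every measurable $f:X\to\mathbb C$ with $E(|f|)<\infty$ $\mu$-a.e. Let $u,w:X\to\mathbb C$ be conditionable and let $T=M_wEM_u$ be the (possibly unbounded) operator on $L^2(\mu)=L^2(X,\Sigma,\mu;\mathbb C)$ given by $$Tf=w\,E(uf),\qquad \mathcal D(T)=\{f\in L^2(\mu): uf \text{ is conditionable and } wE(uf)\in L^2(\mu)\}.$$ Suppose that $T$ is densely defined, and let $T^*$ be its adjoint. Then the following are equivalent: 1. the range $\mathcal R(T)$ is closed in $L^2(\mu)$; 2. the range $\mathcal R(T^*)$ is closed in $L^2(\mu)$; 3. there is a real number $r>0$ such that $E(|u|^2)\,E(|w|^2)\ge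 r$ $\mu$-a.e. on the set $S=\{E(|u|^2)\neq 0\}\cap\{E(|w|^2)\neq 0\}$. -/

import Mathlib

open MeasureTheory
open scoped ENNReal

/-- A complex function `f` is conditionable with respect to the sub-σ-algebra `m` when it is
(a.e.-)measurable and `E(|f|) < ∞` almost everywhere. Here `condLExp m μ` is the conditional
expectation of `[0, ∞]`-valued functions. -/
def IsConditionable {X : Type*} (m : MeasurableSpace X) {m0 : MeasurableSpace X} (μ : Measure X)
    (f : X → ℂ) : Prop :=
  AEMeasurable f μ ∧ ∀ᵐ x ∂μ, condLExp m μ (fun y => ‖f y‖ₑ) x < ∞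

/-- Conditional expectation of a real function: `E(f) = E(f⁺) - E(f⁻)`. No integrability of `f` is
needed: it is meaningful as soon as `E(|f|) < ∞` a.e. -/
noncomputable def realCondExp {X : Type*} (m : MeasurableSpace X) {m0 : MeasurableSpace X}
    (μ : Measure X) (f : X → ℝ) (x : X) : ℝ :=
  (condLExp m μ (fun y => ENNReal.ofReal (f y)) x).toReal -
    (condLExp m μ (fun y => ENNReal.ofReal (-f y)) x).toReal

/-- Conditional expectation of a conditionable complex function: `E(f) = E(Re f) + i E(Im f)`. -/
noncomputable def complexCondExp {X : Type*} (m : MeasurableSpace X) {m0 : MeasurableSpace X}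
    (μ : Measure X) (f : X → ℂ) (x : X) : ℂ :=
  ⟨realCondExp m μ (fun y => (f y).re) x, realCondExp m μ (fun y => (f y).im) x⟩

namespace WCTaux

variable {X : Type*} {m m0 : MeasurableSpace X} {μ : Measure X}

theorem realCondExp_congr {f g : X → ℝ} (h : f =ᵐ[μ] g) :
    realCondExp m μ f =ᵐ[μ] realCondExp m μ g := by
  have h1 : condLExp m μ (fun y => ENNReal.ofReal (f y)) =ᵐ[μ]
      condLExp m μ (fun y => ENNReal.ofReal (g y)) :=
    condLExp_congr_ae (by filter_upwards [h] with x hx; rw [hx])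
  have h2 : condLExp m μ (fun y => ENNReal.ofReal (-f y)) =ᵐ[μ]
      condLExp m μ (fun y => ENNReal.ofReal (-g y)) :=
    condLExp_congr_ae (by filter_upwards [h] with x hx; rw [hx])
  filter_upwards [h1, h2] with x e1 e2
  simp only [realCondExp, e1, e2]

theorem lt_top_of_le {f : X → ℝ≥0∞} {g : X → ℝ≥0∞} (h : f ≤ g)
    (hg : ∀ᵐ x ∂μ, condLExp m μ g x < ∞) : ∀ᵐ x ∂μ, condLExp m μ f x < ∞ := by
  have := condLExp_mono (mΩ := m) (P := μ) (Filter.Eventually.of_forall h)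
  filter_upwards [this, hg] with x h1 h2 using lt_of_le_of_lt h1 h2

theorem realCondExp_add {f g : X → ℝ} (hf : AEMeasurable f μ) (hg : AEMeasurable g μ)
    (hf' : ∀ᵐ x ∂μ, condLExp m μ (fun y => ‖f y‖ₑ) x < ∞)
    (hg' : ∀ᵐ x ∂μ, condLExp m μ (fun y => ‖g y‖ₑ) x < ∞) :
    realCondExp m μ (fun y => f y + g y) =ᵐ[μ]
      fun x => realCondExp m μ f x + realCondExp m μ g x := by
  have le1 : ∀ a : ℝ, ENNReal.ofReal a ≤ ‖a‖ₑ := fun a => Real.ofReal_le_enorm a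
  have le2 : ∀ a : ℝ, ENNReal.ofReal (-a) ≤ ‖a‖ₑ := fun a => by
    simpa using Real.ofReal_le_enorm (-a)
  have fp := lt_top_of_le (m := m) (f := fun y => ENNReal.ofReal (f y)) (fun y => le1 (f y)) hf'
  have fn := lt_top_of_le (m := m) (f := fun y => ENNReal.ofReal (-f y)) (fun y => le2 (f y)) hf'
  have gp := lt_top_of_le (m := m) (f := fun y => ENNReal.ofReal (g y)) (fun y => le1 (g y)) hg'
  have gn := lt_top_of_le (m := m) (f := fun y => ENNReal.ofReal (-g y)) (fun y => le2 (g y)) hg'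
  have hsum : ∀ᵐ x ∂μ, condLExp m μ (fun y => ‖f y‖ₑ + ‖g y‖ₑ) x < ∞ := by
    have := condLExp_add_left (mΩ := m) (P := μ) (fun y => ‖g y‖ₑ) hf.enorm
    filter_upwards [this, hf', hg'] with x h1 h2 h3
    have h4 : condLExp m μ (fun y => ‖f y‖ₑ + ‖g y‖ₑ) x = _ := h1
    rw [h4]
    exact ENNReal.add_lt_top.2 ⟨h2, h3⟩
  have sp := lt_top_of_le (m := m) (f := fun y => ENNReal.ofReal (f y + g y))
    (fun y => (le1 _).trans (enorm_add_le _ _)) hsum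
  have sn := lt_top_of_le (m := m) (f := fun y => ENNReal.ofReal (-(f y + g y)))
    (fun y => (le2 _).trans (enorm_add_le _ _)) hsum
  have hid : (fun y => ENNReal.ofReal (f y + g y)) +
        ((fun y => ENNReal.ofReal (-f y)) + fun y => ENNReal.ofReal (-g y)) =
      (fun y => ENNReal.ofReal (-(f y + g y))) +
        ((fun y => ENNReal.ofReal (f y)) + fun y => ENNReal.ofReal (g y)) := by
    funext y
    simp only [Pi.add_apply]
    rw [← ENNReal.toReal_eq_toReal_iff' (by finiteness) (by finiteness)]
    repeat rw [ENNReal.toReal_add (by finiteness) (by finiteness)]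
    simp only [ENNReal.toReal_ofReal']
    have e : ∀ a : ℝ, max a 0 - max (-a) 0 = a := fun a => max_zero_sub_max_neg_zero_eq_self a
    linarith [e (f y + g y), e (f y), e (g y)]
  have A1 := condLExp_add_left (mΩ := m) (P := μ) (X := fun y => ENNReal.ofReal (f y + g y))
    ((fun y => ENNReal.ofReal (-f y)) + fun y => ENNReal.ofReal (-g y)) (hf.add hg).ennreal_ofReal
  have A2 := condLExp_add_left (mΩ := m) (P := μ) (X := fun y => ENNReal.ofReal (-f y))
    (fun y => ENNReal.ofReal (-g y)) hf.neg.ennreal_ofReal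
  have B1 := condLExp_add_left (mΩ := m) (P := μ) (X := fun y => ENNReal.ofReal (-(f y + g y)))
    ((fun y => ENNReal.ofReal (f y)) + fun y => ENNReal.ofReal (g y))
    (hf.add hg).neg.ennreal_ofReal
  have B2 := condLExp_add_left (mΩ := m) (P := μ) (X := fun y => ENNReal.ofReal (f y))
    (fun y => ENNReal.ofReal (g y)) hf.ennreal_ofReal
  rw [hid] at A1
  filter_upwards [fp, fn, gp, gn, sp, sn, A1, A2, B1, B2]
    with x fp fn gp gn sp sn A1 A2 B1 B2
  rw [B1] at A1
  simp only [Pi.add_apply] at A1 A2 B2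
  rw [A2, B2] at A1
  have := congrArg ENNReal.toReal A1
  rw [ENNReal.toReal_add sn.ne (ENNReal.add_lt_top.2 ⟨fp, gp⟩).ne,
    ENNReal.toReal_add fp.ne gp.ne,
    ENNReal.toReal_add sp.ne (ENNReal.add_lt_top.2 ⟨fn, gn⟩).ne,
    ENNReal.toReal_add fn.ne gn.ne] at this
  simp only [realCondExp]
  linarith

theorem realCondExp_neg (f : X → ℝ) (x : X) :
    realCondExp m μ (fun y => -f y) x = -realCondExp m μ f x := by
  simp [realCondExp]

theorem realCondExp_mul_of_nonneg {f : X → ℝ} (hf : AEMeasurable f μ) {c : ℝ} (hc : 0 ≤ c) :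
    realCondExp m μ (fun y => c * f y) =ᵐ[μ] fun x => c * realCondExp m μ f x := by
  have h1 := condLExp_smul (mΩ := m) (P := μ) (fun y => ENNReal.ofReal (f y)) hf.ennreal_ofReal
    (ENNReal.ofReal c)
  have h2 := condLExp_smul (mΩ := m) (P := μ) (fun y => ENNReal.ofReal (-f y))
    hf.neg.ennreal_ofReal (ENNReal.ofReal c)
  have e1 : (fun y => ENNReal.ofReal (c * f y)) =
      ENNReal.ofReal c • fun y => ENNReal.ofReal (f y) := by
    funext y; simp [ENNReal.ofReal_mul hc]
  have e2 : (fun y => ENNReal.ofReal (-(c * f y))) =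
      ENNReal.ofReal c • fun y => ENNReal.ofReal (-f y) := by
    funext y; simp [← ENNReal.ofReal_mul hc]
  filter_upwards [h1, h2] with x h1 h2
  simp only [realCondExp]
  rw [e1, e2, h1, h2]
  simp only [Pi.smul_apply, smul_eq_mul, ENNReal.toReal_mul, ENNReal.toReal_ofReal hc]
  ring

theorem realCondExp_mul {f : X → ℝ} (hf : AEMeasurable f μ) (c : ℝ) :
    realCondExp m μ (fun y => c * f y) =ᵐ[μ] fun x => c * realCondExp m μ f x := by
  rcases le_total 0 c with hc | hc
  · exact realCondExp_mul_of_nonneg hf hc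
  · have := realCondExp_mul_of_nonneg (m := m) hf (neg_nonneg.2 hc)
    filter_upwards [this] with x hx
    have e : (fun y => -c * f y) = fun y => -(c * f y) := by funext y; ring
    rw [e, realCondExp_neg] at hx
    linarith

theorem enorm_re_le (z : ℂ) : ‖z.re‖ₑ ≤ ‖z‖ₑ :=
  enorm_le_iff_norm_le.2 (Complex.abs_re_le_norm z)

theorem enorm_im_le (z : ℂ) : ‖z.im‖ₑ ≤ ‖z‖ₑ :=
  enorm_le_iff_norm_le.2 (Complex.abs_im_le_norm z)

theorem _root_.IsConditionable.congr {f g : X → ℂ} (hf : IsConditionable m μ f) (h : f =ᵐ[μ] g) :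
    IsConditionable m μ g := by
  refine ⟨hf.1.congr h, ?_⟩
  have := condLExp_congr_ae (mΩ := m) (P := μ) (X := fun y => ‖f y‖ₑ) (Y := fun y => ‖g y‖ₑ)
    (by filter_upwards [h] with x hx; rw [hx])
  filter_upwards [this, hf.2] with x h1 h2
  rwa [← h1]

theorem _root_.IsConditionable.add {f g : X → ℂ} (hf : IsConditionable m μ f)
    (hg : IsConditionable m μ g) : IsConditionable m μ (fun y => f y + g y) := by
  refine ⟨hf.1.add hg.1, ?_⟩
  have hsum : ∀ᵐ x ∂μ, condLExp m μ (fun y => ‖f y‖ₑ + ‖g y‖ₑ) x < ∞ := by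
    have := condLExp_add_left (mΩ := m) (P := μ) (fun y => ‖g y‖ₑ) hf.1.enorm
    filter_upwards [this, hf.2, hg.2] with x h1 h2 h3
    have h4 : condLExp m μ (fun y => ‖f y‖ₑ + ‖g y‖ₑ) x = _ := h1
    rw [h4]
    exact ENNReal.add_lt_top.2 ⟨h2, h3⟩
  exact lt_top_of_le (fun y => enorm_add_le _ _) hsum

theorem _root_.IsConditionable.const_mul {f : X → ℂ} (hf : IsConditionable m μ f) (c : ℂ) :
    IsConditionable m μ (fun y => c * f y) := by
  refine ⟨hf.1.const_mul c, ?_⟩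
  have := condLExp_smul (mΩ := m) (P := μ) (fun y => ‖f y‖ₑ) hf.1.enorm ‖c‖ₑ
  have e : (fun y => ‖c * f y‖ₑ) = ‖c‖ₑ • fun y => ‖f y‖ₑ := by funext y; simp [enorm_mul]
  filter_upwards [this, hf.2] with x h1 h2
  rw [e, h1]
  exact ENNReal.mul_lt_top enorm_lt_top h2

theorem _root_.IsConditionable.zero : IsConditionable m μ (fun _ => (0 : ℂ)) := by
  refine ⟨aemeasurable_const, ?_⟩
  have e : (fun _ : X => ‖(0 : ℂ)‖ₑ) = 0 := by funext y; simp
  rw [e, condLExp_zero]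
  simp

theorem _root_.IsConditionable.aemeasurable_re {f : X → ℂ} (hf : IsConditionable m μ f) :
    AEMeasurable (fun y => (f y).re) μ :=
  Complex.measurable_re.comp_aemeasurable hf.1

theorem _root_.IsConditionable.aemeasurable_im {f : X → ℂ} (hf : IsConditionable m μ f) :
    AEMeasurable (fun y => (f y).im) μ :=
  Complex.measurable_im.comp_aemeasurable hf.1

theorem _root_.IsConditionable.re {f : X → ℂ} (hf : IsConditionable m μ f) :
    ∀ᵐ x ∂μ, condLExp m μ (fun y => ‖(f y).re‖ₑ) x < ∞ :=
  lt_top_of_le (fun y => enorm_re_le (f y)) hf.2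

theorem _root_.IsConditionable.im {f : X → ℂ} (hf : IsConditionable m μ f) :
    ∀ᵐ x ∂μ, condLExp m μ (fun y => ‖(f y).im‖ₑ) x < ∞ :=
  lt_top_of_le (fun y => enorm_im_le (f y)) hf.2

theorem complexCondExp_congr {f g : X → ℂ} (h : f =ᵐ[μ] g) :
    complexCondExp m μ f =ᵐ[μ] complexCondExp m μ g := by
  have h1 := realCondExp_congr (m := m) (μ := μ) (f := fun y => (f y).re) (g := fun y => (g y).re)
    (by filter_upwards [h] with x hx; rw [hx])
  have h2 := realCondExp_congr (m := m) (μ := μ) (f := fun y => (f y).im) (g := fun y => (g y).im)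
    (by filter_upwards [h] with x hx; rw [hx])
  filter_upwards [h1, h2] with x h1 h2
  simp only [complexCondExp, h1, h2]

theorem complexCondExp_add {f g : X → ℂ} (hf : IsConditionable m μ f)
    (hg : IsConditionable m μ g) :
    complexCondExp m μ (fun y => f y + g y) =ᵐ[μ]
      fun x => complexCondExp m μ f x + complexCondExp m μ g x := by
  have h1 := realCondExp_add (m := m) hf.aemeasurable_re hg.aemeasurable_re hf.re hg.re
  have h2 := realCondExp_add (m := m) hf.aemeasurable_im hg.aemeasurable_im hf.im hg.im
  filter_upwards [h1, h2] with x h1 h2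
  apply Complex.ext
  · simpa [complexCondExp] using h1
  · simpa [complexCondExp] using h2

theorem complexCondExp_const_mul {f : X → ℂ} (hf : IsConditionable m μ f) (c : ℂ) :
    complexCondExp m μ (fun y => c * f y) =ᵐ[μ] fun x => c * complexCondExp m μ f x := by
  have fin : ∀ (d : ℝ) {g : X → ℝ}, AEMeasurable g μ →
      (∀ᵐ x ∂μ, condLExp m μ (fun y => ‖g y‖ₑ) x < ∞) →
      ∀ᵐ x ∂μ, condLExp m μ (fun y => ‖d * g y‖ₑ) x < ∞ := by
    intro d g hg hg'
    have := condLExp_smul (mΩ := m) (P := μ) (fun y => ‖g y‖ₑ) hg.enorm ‖d‖ₑ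
    have e : (fun y => ‖d * g y‖ₑ) = ‖d‖ₑ • fun y => ‖g y‖ₑ := by funext y; simp [enorm_mul]
    filter_upwards [this, hg'] with x h1 h2
    rw [e, h1]
    exact ENNReal.mul_lt_top enorm_lt_top h2
  have r1 := realCondExp_mul (m := m) hf.aemeasurable_re c.re
  have r2 := realCondExp_mul (m := m) hf.aemeasurable_im (-c.im)
  have r3 := realCondExp_mul (m := m) hf.aemeasurable_im c.re
  have r4 := realCondExp_mul (m := m) hf.aemeasurable_re c.im
  have a1 := realCondExp_add (m := m) (hf.aemeasurable_re.const_mul c.re) (hf.aemeasurable_im.const_mul (-c.im))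
    (fin _ hf.aemeasurable_re hf.re) (fin _ hf.aemeasurable_im hf.im)
  have a2 := realCondExp_add (m := m) (hf.aemeasurable_im.const_mul c.re) (hf.aemeasurable_re.const_mul c.im)
    (fin _ hf.aemeasurable_im hf.im) (fin _ hf.aemeasurable_re hf.re)
  filter_upwards [r1, r2, r3, r4, a1, a2] with x r1 r2 r3 r4 a1 a2
  rw [r1, r2] at a1
  rw [r3, r4] at a2
  have e1 : (fun y => (c * f y).re) = fun y => c.re * (f y).re + -c.im * (f y).im := by
    funext y; simp [Complex.mul_re]; ring
  have e2 : (fun y => (c * f y).im) = fun y => c.re * (f y).im + c.im * (f y).re := by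
    funext y; simp [Complex.mul_im]
  apply Complex.ext
  · simp only [complexCondExp, e1]
    rw [Complex.mul_re]
    rw [a1]; ring
  · simp only [complexCondExp, e2]
    rw [Complex.mul_im]
    rw [a2]

end WCTaux

/-- The maximal domain of `f ↦ w E(u f)`: all `f ∈ L²(μ)` such that `u f` is conditionable and
`w E(u f) ∈ L²(μ)`. -/
noncomputable def wctDomain {X : Type*} (m : MeasurableSpace X) {m0 : MeasurableSpace X}
    (μ : Measure X) (u w : X → ℂ) : Submodule ℂ (Lp ℂ 2 μ) where
  carrier := {f | IsConditionable m μ (fun x => u x * f x) ∧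
    MemLp (fun x => w x * complexCondExp m μ (fun y => u y * f y) x) 2 μ}
  add_mem' := by
    rintro f g ⟨hf, hf'⟩ ⟨hg, hg'⟩
    have e : (fun x => u x * f x + u x * g x) =ᵐ[μ] fun x => u x * (f + g : Lp ℂ 2 μ) x := by
      filter_upwards [Lp.coeFn_add f g] with x hx
      rw [hx, Pi.add_apply, mul_add]
    refine ⟨(hf.add hg).congr e, (hf'.add hg').ae_eq ?_⟩
    filter_upwards [WCTaux.complexCondExp_congr (m := m) e, WCTaux.complexCondExp_add hf hg]
      with x h1 h2
    rw [Pi.add_apply, ← h1, h2, mul_add]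
  zero_mem' := by
    have e : (fun _ => (0 : ℂ)) =ᵐ[μ] fun x => u x * (0 : Lp ℂ 2 μ) x := by
      filter_upwards [Lp.coeFn_zero ℂ 2 μ] with x hx
      rw [hx, Pi.zero_apply, mul_zero]
    refine ⟨IsConditionable.zero.congr e, (MemLp.zero : MemLp (0 : X → ℂ) 2 μ).ae_eq ?_⟩
    filter_upwards [WCTaux.complexCondExp_congr (m := m) e] with x h1
    have z : (fun _ : X => (0 : ℝ≥0∞)) = 0 := rfl
    rw [← h1]
    apply Complex.ext <;> simp [complexCondExp, realCondExp, z]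
  smul_mem' := by
    rintro c f ⟨hf, hf'⟩
    have e : (fun x => c * (u x * f x)) =ᵐ[μ] fun x => u x * (c • f : Lp ℂ 2 μ) x := by
      filter_upwards [Lp.coeFn_smul c f] with x hx
      rw [hx, Pi.smul_apply, smul_eq_mul]; ring
    refine ⟨(hf.const_mul c).congr e, (hf'.const_mul c).ae_eq ?_⟩
    filter_upwards [WCTaux.complexCondExp_congr (m := m) e, WCTaux.complexCondExp_const_mul hf c]
      with x h1 h2
    rw [← h1, h2]; ring

/-- The (in general unbounded) weighted conditional type operator `M_w E M_u : f ↦ w E(u f)` on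
`L²(μ)`, with its maximal domain. -/
noncomputable def wctOperator {X : Type*} (m : MeasurableSpace X) {m0 : MeasurableSpace X}
    (μ : Measure X) (u w : X → ℂ) : Lp ℂ 2 μ →ₗ.[ℂ] Lp ℂ 2 μ where
  domain := wctDomain m μ u w
  toFun :=
    { toFun := fun f => f.2.2.toLp
      map_add' := by
        rintro ⟨f, hf, hf'⟩ ⟨g, hg, hg'⟩
        have e : (fun x => u x * f x + u x * g x) =ᵐ[μ] fun x => u x * (f + g : Lp ℂ 2 μ) x := by
          filter_upwards [Lp.coeFn_add f g] with x hx
          rw [hx, Pi.add_apply, mul_add]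
        rw [← MemLp.toLp_add]
        refine MemLp.toLp_congr _ _ ?_
        filter_upwards [WCTaux.complexCondExp_congr (m := m) e, WCTaux.complexCondExp_add hf hg]
          with x h1 h2
        rw [Pi.add_apply, ← mul_add, ← h2, h1]
        rfl
      map_smul' := by
        rintro c ⟨f, hf, hf'⟩
        have e : (fun x => c * (u x * f x)) =ᵐ[μ] fun x => u x * (c • f : Lp ℂ 2 μ) x := by
          filter_upwards [Lp.coeFn_smul c f] with x hx
          rw [hx, Pi.smul_apply, smul_eq_mul]; ring
        rw [RingHom.id_apply, ← MemLp.toLp_const_smul]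
        refine MemLp.toLp_congr _ _ ?_
        filter_upwards [WCTaux.complexCondExp_congr (m := m) e,
          WCTaux.complexCondExp_const_mul hf c] with x h1 h2
        rw [Pi.smul_apply, smul_eq_mul, mul_left_comm, ← h2, h1]
        rfl }

/-! Write `U = E(|u|²)` and `W = E(|w|²)`, both with values in `[0, ∞]`. The proof describes the
range of `T` explicitly (`mem_range_wctOperator`): it consists of the square integrable functions `w
g` with `g` measurable for the subalgebra and `∫ |g|²/U < ∞`. Necessity of the integral condition is
the conditional Cauchy–Schwarz inequality `|E(uf)|²/U ≤ E(|f|²)`. Sufficiency is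
`exists_complexCondExp_mul_eq`, which solves `E(uf) = g` with `f` close to the minimal-norm
candidate `g ū / U`; truncating `u` deals with `U = ∞`.

Since `∫ |w g|² = ∫ |g|² W`, closedness of the range compares two weights: the range is the part of
`L²(W dμ)` on which the `1/U`-weighted norm is also finite. If `UW ≥ r` on `S`, then `1/U ≤ W/r`
there and a limit of elements `w g` keeps a finite `1/U`-norm (`isClosed_range_of_le`). If `1/(UW)`
is essentially unbounded on `S`, some `w g` in `L²` has infinite `1/U`-norm but is a limit of
truncations lying in the range (`exists_le_of_isClosed_range`).

For the adjoint, `range_adjoint_wctOperator` shows that `T*` has the same range as the operator `f ↦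
ū E(w̄ f)`, which is of the same type. The criterion is symmetric in `U` and `W`, so both ranges are
closed under the same condition. -/

namespace MeasureTheory

/-! ### Conditional expectation of `[0, ∞]`-valued functions -/

variable {X : Type*} {m m0 : MeasurableSpace X} {μ : Measure X}

theorem trim_withDensity_eq_withDensity_condLExp (hm : m ≤ m0) [SigmaFinite (μ.trim hm)]
    (f : X → ℝ≥0∞) :
    (μ.withDensity f).trim hm = (μ.trim hm).withDensity (condLExp m μ f) := by
  refine @Measure.ext _ m _ _ fun s hs => ?_
  rw [trim_measurableSet_eq hm hs, withDensity_apply _ (hm s hs), withDensity_apply _ hs,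
    setLIntegral_condLExp_trim hm μ f hs]

/-- Both sides are the integral of `t` against `f dμ`, computed on the subalgebra and on the full
σ-algebra. Passing through densities avoids approximation by simple functions. -/
theorem lintegral_mul_condLExp (hm : m ≤ m0) [SigmaFinite (μ.trim hm)] {t f : X → ℝ≥0∞}
    (ht : Measurable[m] t) (hf : AEMeasurable f μ) :
    ∫⁻ x, t x * condLExp m μ f x ∂μ = ∫⁻ x, t x * f x ∂μ := by
  have h1 := lintegral_withDensity_eq_lintegral_mul₀' hf
    ((ht.mono hm le_rfl).aemeasurable : AEMeasurable t (μ.withDensity f))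
  have h2 := lintegral_withDensity_eq_lintegral_mul (μ.trim hm) (measurable_condLExp m μ f) ht
  rw [← trim_withDensity_eq_withDensity_condLExp hm f, lintegral_trim hm ht, h1,
    lintegral_trim hm ((measurable_condLExp m μ f).mul ht)] at h2
  simpa only [Pi.mul_apply, mul_comm] using h2.symm

/-- The pull-out property of the conditional Lebesgue expectation. -/
theorem condLExp_mul_of_measurable (hm : m ≤ m0) [SigmaFinite (μ.trim hm)] {t f : X → ℝ≥0∞}
    (ht : Measurable[m] t) (hf : AEMeasurable f μ) :
    condLExp m μ (fun x => t x * f x) =ᵐ[μ] fun x => t x * condLExp m μ f x := by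
  refine (ae_eq_condLExp hm μ _ (ht.mul (measurable_condLExp m μ f)) fun s hs => ?_).symm
  have h := lintegral_mul_condLExp hm (ht.indicator hs) hf
  simp only [← Set.indicator_mul_left] at h
  rwa [lintegral_indicator (hm s hs), lintegral_indicator (hm s hs)] at h

theorem ae_eq_zero_of_condLExp_eq_zero (hm : m ≤ m0) [SigmaFinite (μ.trim hm)] {f : X → ℝ≥0∞}
    (hf : AEMeasurable f μ) : ∀ᵐ x ∂μ, condLExp m μ f x = 0 → f x = 0 := by
  have hs : MeasurableSet[m] {x | condLExp m μ f x = 0} :=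
    measurable_condLExp m μ f (measurableSet_singleton 0)
  have h := setLIntegral_condLExp hm μ f hs
  rw [setLIntegral_congr_fun (g := fun _ => 0) (hm _ hs) (fun x hx => hx), lintegral_zero,
    eq_comm, lintegral_eq_zero_iff' hf.restrict, Filter.EventuallyEq,
    ae_restrict_iff' (hm _ hs)] at h
  exact h

theorem condLExp_eq_zero_of_forall_eq_zero (hm : m ≤ m0) [SigmaFinite (μ.trim hm)]
    {f : X → ℝ≥0∞} {s : Set X} (hs : MeasurableSet[m] s)
    (h : ∀ᵐ x ∂μ, x ∈ s → f x = 0) : ∀ᵐ x ∂μ, x ∈ s → condLExp m μ f x = 0 := by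
  have h1 := setLIntegral_condLExp hm μ f hs
  rw [setLIntegral_congr_fun_ae (g := fun _ => 0) (hm _ hs) h, lintegral_zero,
    lintegral_eq_zero_iff' (by fun_prop), Filter.EventuallyEq, ae_restrict_iff' (hm _ hs)] at h1
  exact h1

theorem _root_.ENNReal.two_mul_mul_le_add_sq (a b : ℝ≥0∞) : 2 * (a * b) ≤ a ^ 2 + b ^ 2 := by
  rcases eq_or_ne a ∞ with rfl | ha
  · simp
  rcases eq_or_ne b ∞ with rfl | hb
  · simp
  lift a to NNReal using ha
  lift b to NNReal using hb
  norm_cast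
  rw [← mul_assoc]
  exact two_mul_le_add_sq a b

/-- The conditional Cauchy–Schwarz inequality. -/
theorem condLExp_mul_sq_mul_inv_le (hm : m ≤ m0) [SigmaFinite (μ.trim hm)] {f g : X → ℝ≥0∞}
    (hf : AEMeasurable f μ) (hg : AEMeasurable g μ)
    (hfg : ∀ᵐ x ∂μ, condLExp m μ (fun y => f y * g y) x < ∞) :
    ∀ᵐ x ∂μ, condLExp m μ (fun y => f y * g y) x ^ 2 * (condLExp m μ (fun y => f y ^ 2) x)⁻¹ ≤
      condLExp m μ (fun y => g y ^ 2) x := by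
  set c := condLExp m μ (fun y => f y * g y) with hc
  set U := condLExp m μ (fun y => f y ^ 2) with hU
  have cm : Measurable[m] c := measurable_condLExp _ _ _
  have Um : Measurable[m] U := measurable_condLExp _ _ _
  -- The multiplier `t = c/U` is the minimiser of `E((t f - g)²)`. In `2 t f g ≤ t² f² + g²` it can
  -- be pulled out, leaving `2c²/U ≤ c²/U + E(g²)`, from which the finite term `c²/U` is cancelled.
  have tm : Measurable[m] fun x => c x * (U x)⁻¹ := cm.mul Um.inv
  have z1 := ae_eq_zero_of_condLExp_eq_zero hm (hf.pow_const 2)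
  -- Where `U = 0` the inverse `U⁻¹` is `∞`, so the inequality survives only because `c` vanishes
  -- there.
  have z2 := condLExp_eq_zero_of_forall_eq_zero (f := fun y => f y * g y) hm
    (Um (measurableSet_singleton 0))
    (by filter_upwards [z1] with x hx h
        simp [pow_eq_zero_iff (two_ne_zero) |>.1 (hx h)])
  have e1 := condLExp_mul_of_measurable hm (f := fun y => f y * g y) (tm.const_mul 2) (hf.mul hg)
  have e2 := condLExp_mul_of_measurable hm (tm.pow_const 2) (hf.pow_const 2)
  have e3 := condLExp_add_right (mΩ := m) (P := μ) (fun y => (c y * (U y)⁻¹) ^ 2 * f y ^ 2)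
    (hg.pow_const 2)
  have e4 := condLExp_mono (mΩ := m) (P := μ)
    (X := fun y => 2 * (c y * (U y)⁻¹) * (f y * g y))
    (Y := fun y => (c y * (U y)⁻¹) ^ 2 * f y ^ 2 + g y ^ 2) (Filter.Eventually.of_forall fun y => by
      have := ENNReal.two_mul_mul_le_add_sq (c y * (U y)⁻¹ * f y) (g y)
      rw [mul_pow] at this
      simpa only [mul_assoc] using this)
  filter_upwards [z2, e1, e2, e3, e4, hfg] with x z2 e1 e2 e3 e4 hfg
  rcases eq_or_ne (U x) 0 with h0 | h0
  · have : c x = 0 := z2 h0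
    simp [this]
  rcases eq_or_ne (U x) ∞ with h1 | h1
  · simp [h1]
  have e5 : 2 * (c x * (U x)⁻¹) * c x ≤
      (c x * (U x)⁻¹) ^ 2 * U x + condLExp m μ (fun y => g y ^ 2) x := by
    rw [← e1, ← e2]
    exact e4.trans e3.le
  have e6 : (c x * (U x)⁻¹) ^ 2 * U x = c x ^ 2 * (U x)⁻¹ := by
    rw [mul_pow, mul_assoc, sq (U x)⁻¹, mul_assoc, ENNReal.inv_mul_cancel h0 h1, mul_one]
  have e7 : 2 * (c x * (U x)⁻¹) * c x = c x ^ 2 * (U x)⁻¹ + c x ^ 2 * (U x)⁻¹ := by ring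
  rw [e6, e7] at e5
  refine (ENNReal.add_le_add_iff_left ?_).1 e5
  exact ENNReal.mul_ne_top (by finiteness) (ENNReal.inv_ne_top.2 h0)

end MeasureTheory

/-! ### Conditional expectation of complex functions -/

namespace WCTaux

variable {X : Type*} {m m0 : MeasurableSpace X} {μ : Measure X}

theorem measurable_complexCondExp (f : X → ℂ) : Measurable[m] (complexCondExp m μ f) := by
  have h : ∀ g : X → ℝ, Measurable[m] (realCondExp m μ g) := fun g =>
    (measurable_condLExp m μ _).ennreal_toReal.sub (measurable_condLExp m μ _).ennreal_toReal
  exact Complex.measurableEquivRealProd.symm.measurable.comp ((h _).prodMk (h _))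

theorem isConditionable_mul (hm : m ≤ m0) [SigmaFinite (μ.trim hm)] {a f : X → ℂ}
    (ha : Measurable[m] a) (hf : IsConditionable m μ f) :
    IsConditionable m μ fun x => a x * f x := by
  refine ⟨(ha.mono hm le_rfl).aemeasurable.mul hf.1, ?_⟩
  simp only [enorm_mul]
  filter_upwards [condLExp_mul_of_measurable (t := fun x => ‖a x‖ₑ) hm
    (measurable_enorm.comp ha) hf.1.enorm, hf.2] with x h1 h2
  rw [h1]
  exact ENNReal.mul_lt_top enorm_lt_top h2

theorem condLExp_enorm_mul_lt_top (hm : m ≤ m0) [SigmaFinite (μ.trim hm)] {a f : X → ℝ}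
    (ha : Measurable[m] a) (hf : AEMeasurable f μ)
    (hf' : ∀ᵐ x ∂μ, condLExp m μ (fun y => ‖f y‖ₑ) x < ∞) :
    ∀ᵐ x ∂μ, condLExp m μ (fun y => ‖a y * f y‖ₑ) x < ∞ := by
  simp only [enorm_mul]
  filter_upwards [condLExp_mul_of_measurable (t := fun x => ‖a x‖ₑ) hm
    (measurable_enorm.comp ha) hf.enorm, hf'] with x h1 h2
  rw [h1]
  exact ENNReal.mul_lt_top enorm_lt_top h2

theorem _root_.ENNReal.ofReal_mul_eq_add (a b : ℝ) :
    ENNReal.ofReal (a * b) = ENNReal.ofReal a * ENNReal.ofReal b +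
      ENNReal.ofReal (-a) * ENNReal.ofReal (-b) := by
  rcases le_total 0 a with h | h
  · rw [ENNReal.ofReal_mul h, ENNReal.ofReal_of_nonpos (neg_nonpos.2 h), zero_mul, add_zero]
  · rw [← neg_mul_neg, ENNReal.ofReal_mul (neg_nonneg.2 h), ENNReal.ofReal_of_nonpos h, zero_mul,
      zero_add]

theorem realCondExp_mul_of_measurable (hm : m ≤ m0) [SigmaFinite (μ.trim hm)] {a f : X → ℝ}
    (ha : Measurable[m] a) (hf : AEMeasurable f μ)
    (hf' : ∀ᵐ x ∂μ, condLExp m μ (fun y => ‖f y‖ₑ) x < ∞) :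
    realCondExp m μ (fun y => a y * f y) =ᵐ[μ] fun x => a x * realCondExp m μ f x := by
  -- The positive part of `b g` is `b⁺g⁺ + b⁻g⁻`, to which the nonnegative pull-out applies
  -- termwise. The negative part of `a f` is then the case `b = -a`.
  have key : ∀ {b g : X → ℝ}, Measurable[m] b → AEMeasurable g μ →
      ∀ᵐ x ∂μ, condLExp m μ (fun y => ENNReal.ofReal (b y * g y)) x =
        ENNReal.ofReal (b x) * condLExp m μ (fun y => ENNReal.ofReal (g y)) x +
        ENNReal.ofReal (-b x) * condLExp m μ (fun y => ENNReal.ofReal (-g y)) x := by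
    intro b g hb hg
    have h1 := condLExp_mul_of_measurable hm hb.ennreal_ofReal hg.ennreal_ofReal
    have h2 := condLExp_mul_of_measurable hm hb.neg.ennreal_ofReal hg.neg.ennreal_ofReal
    have h3 := condLExp_add_left (mΩ := m) (P := μ)
      (X := fun y => ENNReal.ofReal (b y) * ENNReal.ofReal (g y))
      (fun y => ENNReal.ofReal (-b y) * ENNReal.ofReal (-g y))
      ((hb.mono hm le_rfl).aemeasurable.ennreal_ofReal.mul hg.ennreal_ofReal)
    filter_upwards [h1, h2, h3] with x h1 h2 h3
    simp only [ENNReal.ofReal_mul_eq_add]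
    exact h3.trans (congrArg₂ (· + ·) h1 h2)
  have fp := lt_top_of_le (m := m) (f := fun y => ENNReal.ofReal (f y))
    (fun y => Real.ofReal_le_enorm (f y)) hf'
  have fn := lt_top_of_le (m := m) (f := fun y => ENNReal.ofReal (-f y))
    (fun y => by simpa using Real.ofReal_le_enorm (-f y)) hf'
  filter_upwards [key ha hf, key ha.neg hf, fp, fn] with x h1 h2 fp fn
  simp only [realCondExp, Pi.neg_apply, neg_mul, neg_neg] at h1 h2 ⊢
  rw [h1, h2]
  repeat rw [ENNReal.toReal_add (by finiteness) (by finiteness)]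
  simp only [ENNReal.toReal_mul, ENNReal.toReal_ofReal']
  linear_combination ((condLExp m μ (fun y => ENNReal.ofReal (f y)) x).toReal -
    (condLExp m μ (fun y => ENNReal.ofReal (-f y)) x).toReal) *
      max_zero_sub_max_neg_zero_eq_self (a x)

theorem complexCondExp_mul_of_measurable (hm : m ≤ m0) [SigmaFinite (μ.trim hm)] {a f : X → ℂ}
    (ha : Measurable[m] a) (hf : IsConditionable m μ f) :
    complexCondExp m μ (fun y => a y * f y) =ᵐ[μ] fun x => a x * complexCondExp m μ f x := by
  have hr : Measurable[m] fun x => (a x).re := Complex.measurable_re.comp ha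
  have hi : Measurable[m] fun x => (a x).im := Complex.measurable_im.comp ha
  have ae : ∀ {b : X → ℝ} {g : X → ℝ}, Measurable[m] b → AEMeasurable g μ →
      AEMeasurable (fun x => b x * g x) μ :=
    fun hb hg => (hb.mono hm le_rfl).aemeasurable.mul hg
  have r1 := realCondExp_mul_of_measurable hm hr hf.aemeasurable_re hf.re
  have r2 := realCondExp_mul_of_measurable hm hi.neg hf.aemeasurable_im hf.im
  have r3 := realCondExp_mul_of_measurable hm hr hf.aemeasurable_im hf.im
  have r4 := realCondExp_mul_of_measurable hm hi hf.aemeasurable_re hf.re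
  have a1 := realCondExp_add (ae hr hf.aemeasurable_re) (ae hi.neg hf.aemeasurable_im)
    (condLExp_enorm_mul_lt_top hm hr hf.aemeasurable_re hf.re)
    (condLExp_enorm_mul_lt_top hm hi.neg hf.aemeasurable_im hf.im)
  have a2 := realCondExp_add (ae hr hf.aemeasurable_im) (ae hi hf.aemeasurable_re)
    (condLExp_enorm_mul_lt_top hm hr hf.aemeasurable_im hf.im)
    (condLExp_enorm_mul_lt_top hm hi hf.aemeasurable_re hf.re)
  filter_upwards [r1, r2, r3, r4, a1, a2] with x r1 r2 r3 r4 a1 a2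
  rw [r1, r2] at a1
  rw [r3, r4] at a2
  have e1 : (fun y => (a y * f y).re) =
      fun y => (a y).re * (f y).re + (-fun x => (a x).im) y * (f y).im := by
    funext y; simp [Complex.mul_re]; ring
  have e2 : (fun y => (a y * f y).im) = fun y => (a y).re * (f y).im + (a y).im * (f y).re := by
    funext y; simp [Complex.mul_im]
  apply Complex.ext
  · simp only [complexCondExp, e1]
    rw [Complex.mul_re, a1, Pi.neg_apply]; ring
  · simp only [complexCondExp, e2]
    rw [Complex.mul_im, a2]

theorem complexCondExp_ofReal {f : X → ℝ} (hf : ∀ x, 0 ≤ f x) (x : X) :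
    complexCondExp m μ (fun y => (f y : ℂ)) x =
      ((condLExp m μ (fun y => ENNReal.ofReal (f y)) x).toReal : ℂ) := by
  have z : (fun _ : X => (0 : ℝ≥0∞)) = 0 := rfl
  have e : (fun y => ENNReal.ofReal (-f y)) = 0 := by
    funext y; exact ENNReal.ofReal_of_nonpos (neg_nonpos.2 (hf y))
  apply Complex.ext <;> simp [complexCondExp, realCondExp, z, e]

/-- The conditional triangle inequality. -/
theorem enorm_complexCondExp_le (hm : m ≤ m0) [SigmaFinite (μ.trim hm)] {f : X → ℂ}
    (hf : IsConditionable m μ f) :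
    ∀ᵐ x ∂μ, ‖complexCondExp m μ f x‖ₑ ≤ condLExp m μ (fun y => ‖f y‖ₑ) x := by
  set c := complexCondExp m μ f with hc
  have cm : Measurable[m] c := measurable_complexCondExp f
  -- A measurable phase with `a c = |c|`, equal to `0` where `c = 0`. Pulling it inside gives
  -- `|E(f)| = Re E(a f) ≤ E(|f|)`.
  set a : X → ℂ := fun x => starRingEnd ℂ (c x) * ((‖c x‖⁻¹ : ℝ) : ℂ) with ha
  have am : Measurable[m] a :=
    (Complex.continuous_conj.measurable.comp cm).mul
      (Complex.measurable_ofReal.comp (measurable_norm.comp cm).inv)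
  have hle : ∀ x, ‖a x‖ ≤ 1 := fun x => by
    simp only [ha, norm_mul, RCLike.norm_conj, Complex.norm_real, norm_inv, norm_norm]
    exact mul_inv_le_one
  have h2 := condLExp_mono (mΩ := m) (P := μ) (X := fun y => ENNReal.ofReal (a y * f y).re)
    (Y := fun y => ‖f y‖ₑ) (Filter.Eventually.of_forall fun y => by
      change _ ≤ ‖f y‖ₑ
      rw [← ofReal_norm]
      refine ENNReal.ofReal_le_ofReal ((Complex.re_le_norm _).trans ?_)
      rw [norm_mul]
      exact mul_le_of_le_one_left (norm_nonneg _) (hle y))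
  filter_upwards [complexCondExp_mul_of_measurable hm am hf, h2, hf.2] with x h1 h2 h3
  have h4 : ‖c x‖ = (a x * c x).re := by
    simp only [ha]
    rw [mul_right_comm, Complex.conj_mul', ← Complex.ofReal_pow, ← Complex.ofReal_mul,
      Complex.ofReal_re]
    rcases eq_or_ne ‖c x‖ 0 with h | h
    · simp [h]
    · field_simp
  rw [← ofReal_norm, ENNReal.ofReal_le_iff_le_toReal h3.ne, h4, ← h1]
  refine le_trans (sub_le_self _ ENNReal.toReal_nonneg) (ENNReal.toReal_mono h3.ne h2)

theorem enorm_complexCondExp_mul_sq_mul_inv_le (hm : m ≤ m0) [SigmaFinite (μ.trim hm)]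
    {u f : X → ℂ} (hu : AEMeasurable u μ) (hf : AEMeasurable f μ)
    (huf : IsConditionable m μ fun x => u x * f x) :
    ∀ᵐ x ∂μ, ‖complexCondExp m μ (fun y => u y * f y) x‖ₑ ^ 2 *
        (condLExp m μ (fun y => ‖u y‖ₑ ^ 2) x)⁻¹ ≤ condLExp m μ (fun y => ‖f y‖ₑ ^ 2) x := by
  have h := huf.2
  simp only [enorm_mul] at h
  filter_upwards [enorm_complexCondExp_le hm huf, condLExp_mul_sq_mul_inv_le hm hu.enorm hf.enorm h]
    with x h1 h2
  simp only [enorm_mul] at h1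
  exact le_trans (by gcongr) h2

theorem integral_realCondExp (hm : m ≤ m0) [SigmaFinite (μ.trim hm)] {f : X → ℝ}
    (hf : Integrable f μ) :
    Integrable (realCondExp m μ f) μ ∧ ∫ x, realCondExp m μ f x ∂μ = ∫ x, f x ∂μ := by
  have key : ∀ {g : X → ℝ}, Integrable g μ →
      Integrable (fun x => (condLExp m μ (fun y => ENNReal.ofReal (g y)) x).toReal) μ ∧
      ∫ x, (condLExp m μ (fun y => ENNReal.ofReal (g y)) x).toReal ∂μ =
        (∫⁻ x, ENNReal.ofReal (g x) ∂μ).toReal := by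
    intro g hg
    have h : ∫⁻ x, ENNReal.ofReal (g x) ∂μ ≠ ∞ :=
      ((lintegral_mono fun x => Real.ofReal_le_enorm (g x)).trans_lt hg.2).ne
    refine ⟨integrable_toReal_of_lintegral_ne_top (by fun_prop) ?_, ?_⟩
    · rwa [lintegral_condLExp hm]
    · rw [integral_toReal (by fun_prop) (condLExp_lt_top h), lintegral_condLExp hm]
  refine ⟨(key hf).1.sub (key hf.neg).1, ?_⟩
  rw [integral_eq_lintegral_pos_part_sub_lintegral_neg_part hf, ← (key hf).2]
  have h2 := (key hf.neg).2
  simp only [Pi.neg_apply] at h2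
  rw [← h2]
  exact integral_sub (key hf).1 (key hf.neg).1

theorem integral_complexCondExp (hm : m ≤ m0) [SigmaFinite (μ.trim hm)] {f : X → ℂ}
    (hf : Integrable f μ) : ∫ x, complexCondExp m μ f x ∂μ = ∫ x, f x ∂μ := by
  have h1 := integral_realCondExp hm hf.re
  have h2 := integral_realCondExp hm hf.im
  have hi : Integrable (complexCondExp m μ f) μ := by
    have := (h1.1.ofReal (𝕜 := ℂ)).add ((h2.1.ofReal (𝕜 := ℂ)).const_mul Complex.I)
    refine this.congr (Filter.Eventually.of_forall fun x => ?_)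
    apply Complex.ext <;> simp [complexCondExp]
  rw [← integral_re_add_im hi, ← integral_re_add_im hf]
  exact congrArg₂ _ (congrArg _ h1.2) (congrArg (fun r : ℝ => (r : ℂ) * Complex.I) h2.2)

theorem integral_mul_complexCondExp (hm : m ≤ m0) [SigmaFinite (μ.trim hm)] {a f : X → ℂ}
    (ha : Measurable[m] a) (hf : IsConditionable m μ f) (haf : Integrable (fun x => a x * f x) μ) :
    ∫ x, a x * complexCondExp m μ f x ∂μ = ∫ x, a x * f x ∂μ := by
  rw [← integral_complexCondExp hm haf]
  exact integral_congr_ae (complexCondExp_mul_of_measurable hm ha hf).symm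

theorem complexCondExp_conj (f : X → ℂ) (x : X) :
    complexCondExp m μ (fun y => starRingEnd ℂ (f y)) x = starRingEnd ℂ (complexCondExp m μ f x) := by
  apply Complex.ext <;> simp [complexCondExp, realCondExp_neg]

end WCTaux

/-! ### Monotone convergence, and solving `E(uf) = g` in `L²` -/

namespace MeasureTheory

variable {X : Type*} {m m0 : MeasurableSpace X} {μ : Measure X}

/-- Monotone convergence for the conditional Lebesgue expectation. -/
theorem condLExp_iSup (hm : m ≤ m0) [SigmaFinite (μ.trim hm)] {f : ℕ → X → ℝ≥0∞}
    (hf : ∀ n, AEMeasurable (f n) μ) (hmono : ∀ x, Monotone fun n => f n x) :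
    condLExp m μ (fun x => ⨆ n, f n x) =ᵐ[μ] fun x => ⨆ n, condLExp m μ (f n) x := by
  have hmono' : ∀ᵐ x ∂μ, Monotone fun n => condLExp m μ (f n) x := by
    have : ∀ n, condLExp m μ (f n) ≤ᵐ[μ] condLExp m μ (f (n + 1)) := fun n =>
      condLExp_mono (Filter.Eventually.of_forall fun x => hmono x n.le_succ)
    filter_upwards [ae_all_iff.2 this] with x hx using monotone_nat_of_le_succ hx
  refine (ae_eq_condLExp hm μ _ (Measurable.iSup fun n => measurable_condLExp m μ (f n))
    fun s hs => ?_).symm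
  rw [lintegral_iSup' (fun n => by fun_prop) (ae_restrict_of_ae hmono'),
    lintegral_iSup' (fun n => (hf n).restrict) (Filter.Eventually.of_forall hmono)]
  simp only [setLIntegral_condLExp hm μ _ hs]

end MeasureTheory

namespace WCTaux

variable {X : Type*} {m m0 : MeasurableSpace X} {μ : Measure X}

/-- On each of the countably many sets `{N = n}`, which belong to the subalgebra, truncation at
level `N` is truncation at the constant `n`; pulling out the indicator of `{N = n}` localises the
conditional expectation. -/
theorem condLExp_indicator_enorm_le (hm : m ≤ m0) [SigmaFinite (μ.trim hm)] {u : X → ℂ}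
    (hu : AEMeasurable u μ) {N : X → ℕ} (hN : Measurable[m] N) :
    ∀ᵐ x ∂μ, condLExp m μ (fun y => ‖{z | ‖u z‖ₑ ≤ N z}.indicator u y‖ₑ ^ 2) x =
      condLExp m μ (fun y => ‖{z | ‖u z‖ₑ ≤ N x}.indicator u y‖ₑ ^ 2) x := by
  have hNm : AEMeasurable (fun z => (N z : ℝ≥0∞)) μ :=
    (measurable_from_top.comp (hN.mono hm le_rfl)).aemeasurable
  have h : ∀ n : ℕ, ∀ᵐ x ∂μ, N x = n →
      condLExp m μ (fun y => ‖{z | ‖u z‖ₑ ≤ N z}.indicator u y‖ₑ ^ 2) x =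
      condLExp m μ (fun y => ‖{z | ‖u z‖ₑ ≤ n}.indicator u y‖ₑ ^ 2) x := by
    intro n
    have ht : Measurable[m] ((N ⁻¹' {n}).indicator (1 : X → ℝ≥0∞)) :=
      Measurable.indicator (@measurable_const _ _ _ m 1) (hN (measurableSet_singleton n))
    have e1 := condLExp_mul_of_measurable (μ := μ) hm ht
      ((hu.indicator₀ (nullMeasurableSet_le hu.enorm hNm)).enorm.pow_const 2)
    have e2 := condLExp_mul_of_measurable (μ := μ) hm ht
      ((hu.indicator₀ (nullMeasurableSet_le hu.enorm
        (aemeasurable_const (b := (n : ℝ≥0∞))))).enorm.pow_const 2)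
    have e : (fun y => (N ⁻¹' {n}).indicator (1 : X → ℝ≥0∞) y *
        ‖{z | ‖u z‖ₑ ≤ N z}.indicator u y‖ₑ ^ 2) =
        fun y => (N ⁻¹' {n}).indicator (1 : X → ℝ≥0∞) y *
        ‖{z | ‖u z‖ₑ ≤ n}.indicator u y‖ₑ ^ 2 := by
      funext y
      by_cases hy : N y = n
      · simp only [Set.indicator_apply, Set.mem_ofPred_eq, hy]
      · simp [Set.indicator_apply, hy]
    rw [e] at e1
    filter_upwards [e1, e2] with x e1 e2 hx
    rw [e1] at e2
    simpa [Set.indicator_apply, hx] using e2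
  filter_upwards [ae_all_iff.2 h] with x hx using hx (N x) rfl

/-- The equation `E(uf) = g` is solvable in `L²` as soon as `∫ |g|² / E(|u|²) < ∞`, with almost
optimal norm. -/
theorem exists_complexCondExp_mul_eq (hm : m ≤ m0) [SigmaFinite (μ.trim hm)] {u g : X → ℂ}
    (hu : AEMeasurable u μ) (hg : Measurable[m] g)
    (hgu : ∫⁻ x, ‖g x‖ₑ ^ 2 * (condLExp m μ (fun y => ‖u y‖ₑ ^ 2) x)⁻¹ ∂μ ≠ ∞)
    {ε : ℝ≥0∞} (hε : ε ≠ 0) (hε' : ε ≠ ∞) :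
    ∃ f : X → ℂ, MemLp f 2 μ ∧ IsConditionable m μ (fun x => u x * f x) ∧
      complexCondExp m μ (fun x => u x * f x) =ᵐ[μ] g ∧
      ∫⁻ x, ‖f x‖ₑ ^ 2 ∂μ ≤
        ∫⁻ x, ‖g x‖ₑ ^ 2 * (condLExp m μ (fun y => ‖u y‖ₑ ^ 2) x)⁻¹ ∂μ + ε := by
  set U := condLExp m μ (fun y => ‖u y‖ₑ ^ 2) with hU
  have Um : Measurable[m] U := measurable_condLExp _ _ _
  have gm : Measurable[m] fun x => ‖g x‖ₑ ^ 2 := (measurable_enorm.comp hg).pow_const 2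
  -- The positive weight `θ`, of integral below `ε`, is the slack. It makes `|g|² < U κ` strict
  -- wherever `U ≠ 0`, even if `U = ∞` or `g = 0`, so a finite truncation of `u` already suffices at
  -- almost every point.
  obtain ⟨θ, θpos, θm, hθ⟩ :=
    @exists_pos_lintegral_lt_of_sigmaFinite _ m (μ.trim hm) _ _ hε
  rw [lintegral_trim (f := fun x => (θ x : ℝ≥0∞)) hm (measurable_coe_nnreal_ennreal.comp θm)] at hθ
  set κ : X → ℝ≥0∞ := fun x => ‖g x‖ₑ ^ 2 * (U x)⁻¹ + θ x with hκ
  have κm : Measurable[m] κ :=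
    (gm.mul Um.inv).add (measurable_coe_nnreal_ennreal.comp θm)
  have κint : ∫⁻ x, κ x ∂μ ≤ ∫⁻ x, ‖g x‖ₑ ^ 2 * (U x)⁻¹ ∂μ + ε := by
    have h := lintegral_add_left (μ := μ) ((gm.mul Um.inv).mono hm le_rfl) fun x => (θ x : ℝ≥0∞)
    exact h.trans_le (by gcongr; rfl)
  set t : ℕ → X → ℝ≥0∞ := fun n y => ‖{z | ‖u z‖ₑ ≤ n}.indicator u y‖ₑ ^ 2 with ht
  have tm : ∀ n, AEMeasurable (t n) μ := fun n =>
    (hu.indicator₀ (nullMeasurableSet_le hu.enorm aemeasurable_const)).enorm.pow_const 2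
  have tmono : ∀ x, Monotone fun n => t n x := by
    intro x n k hnk
    simp only [ht, Set.indicator_apply, Set.mem_ofPred_eq]
    have hc : (n : ℝ≥0∞) ≤ k := by exact_mod_cast hnk
    split_ifs with h1 h2
    · exact le_rfl
    · exact absurd (h1.trans hc) h2
    · simp
    · simp
  have tsup : (fun x => ⨆ n, t n x) = fun x => ‖u x‖ₑ ^ 2 := by
    funext x
    refine le_antisymm (iSup_le fun n => ?_) ?_
    · simp only [ht, Set.indicator_apply]
      split_ifs <;> simp
    · obtain ⟨n, hn⟩ := ENNReal.exists_nat_gt (enorm_ne_top (x := u x))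
      refine le_iSup_of_le n ?_
      simp [ht, Set.indicator_apply, hn.le]
  have Vsup := condLExp_iSup hm tm tmono
  rw [tsup] at Vsup
  set V : ℕ → X → ℝ≥0∞ := fun n => condLExp m μ (t n) with hV
  have Vm : ∀ n, Measurable[m] (V n) := fun n => measurable_condLExp _ _ _
  have Vtop : ∀ᵐ x ∂μ, ∀ n, V n x < ∞ := by
    refine ae_all_iff.2 fun n => ?_
    have := condLExp_mono (mΩ := m) (P := μ) (X := t n) (Y := fun _ => (n : ℝ≥0∞) ^ 2)
      (Filter.Eventually.of_forall fun x => by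
        simp only [ht, Set.indicator_apply, Set.mem_ofPred_eq]
        split_ifs with h
        · gcongr
        · simp)
    rw [condLExp_const hm] at this
    filter_upwards [this] with x hx using hx.trans_lt (by finiteness)
  have hex : ∀ᵐ x ∂μ, ∃ n, ‖g x‖ₑ ^ 2 ≤ V n x * κ x := by
    have hfin := ae_lt_top ((gm.mul Um.inv).mono hm le_rfl) hgu
    filter_upwards [Vsup, hfin] with x hx hx'
    rcases eq_or_ne (U x) 0 with h0 | h0
    · have : g x = 0 := by
        by_contra h
        simp [h0, ENNReal.mul_top, h] at hx'
      exact ⟨0, by simp [this]⟩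
    · have hθx : (θ x : ℝ≥0∞) ≠ 0 := by exact_mod_cast (θpos x).ne'
      have hlt : ‖g x‖ₑ ^ 2 < U x * κ x := by
        rcases eq_or_ne (U x) ∞ with h1 | h1
        · rw [h1, ENNReal.top_mul (by simp [hκ, hθx])]
          finiteness
        · have : U x * κ x = ‖g x‖ₑ ^ 2 + U x * θ x := by
            simp only [hκ]
            rw [mul_add, mul_left_comm, ENNReal.mul_inv_cancel h0 h1, mul_one]
          rw [this]
          exact ENNReal.lt_add_right (by finiteness) (mul_ne_zero h0 hθx)
      rw [show U x = ⨆ n, V n x from hx, ENNReal.iSup_mul] at hlt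
      obtain ⟨n, hn⟩ := lt_iSup_iff.1 hlt
      exact ⟨n, hn.le⟩
  have pm : ∀ n, MeasurableSet[m] {x | ‖g x‖ₑ ^ 2 ≤ V n x * κ x} := fun n =>
    measurableSet_le (mδ := m) gm ((Vm n).mul κm)
  -- The second alternative makes `Nat.find` total; by `hex` it occurs only on a null set.
  set p : X → ℕ → Prop := fun x n =>
    ‖g x‖ₑ ^ 2 ≤ V n x * κ x ∨ ∀ k, ¬ ‖g x‖ₑ ^ 2 ≤ V k x * κ x with hp
  have pex : ∀ x, ∃ n, p x n := by
    intro x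
    by_cases h : ∃ n, ‖g x‖ₑ ^ 2 ≤ V n x * κ x
    · exact h.imp fun n hn => Or.inl hn
    · exact ⟨0, Or.inr (not_exists.1 h)⟩
  classical
  set N : X → ℕ := fun x => Nat.find (pex x) with hN
  have pm' : ∀ n, MeasurableSet[m] {x | p x n} := by
    intro n
    have : {x | p x n} = {x | ‖g x‖ₑ ^ 2 ≤ V n x * κ x} ∪
        ⋂ k, {x | ‖g x‖ₑ ^ 2 ≤ V k x * κ x}ᶜ := by
      ext x
      simp [hp]
    rw [this]
    exact (pm n).union (MeasurableSet.iInter fun k => (pm k).compl)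
  have Nm : Measurable[m] N := @measurable_find _ m _ _ pex pm'
  have hNx : ∀ᵐ x ∂μ, ‖g x‖ₑ ^ 2 ≤ V (N x) x * κ x := by
    filter_upwards [hex] with x hx
    exact (Nat.find_spec (pex x)).resolve_right (by simpa using hx)
  set v : X → ℂ := {z | ‖u z‖ₑ ≤ N z}.indicator u with hv
  have vm : AEMeasurable v μ := hu.indicator₀ (nullMeasurableSet_le hu.enorm
    (measurable_from_top.comp (Nm.mono hm le_rfl)).aemeasurable)
  set Q := condLExp m μ (fun y => ‖v y‖ₑ ^ 2) with hQ
  have Qm : Measurable[m] Q := measurable_condLExp _ _ _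
  have hQg : ∀ᵐ x ∂μ, Q x < ∞ ∧ ‖g x‖ₑ ^ 2 ≤ Q x * κ x := by
    filter_upwards [condLExp_indicator_enorm_le hm hu Nm, hNx, Vtop] with x h1 h2 h3
    have : Q x = V (N x) x := h1
    rw [this]
    exact ⟨h3 _, h2⟩
  -- The solution is `f = a v̄` with `a = g/Q`: then `u v̄ = |v|²`, so `E(uf) = a Q = g`, and
  -- `E(|f|²) = |g|²/Q ≤ κ` where `Q ≠ 0`. Where `Q = 0`, `hQg` forces `g = 0`, in agreement with
  -- `0⁻¹ = 0`.
  set a : X → ℂ := fun x => g x * (((Q x).toReal⁻¹ : ℝ) : ℂ) with ha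
  have am : Measurable[m] a := hg.mul (Complex.measurable_ofReal.comp Qm.ennreal_toReal.inv)
  have huv : ∀ x, u x * (a x * starRingEnd ℂ (v x)) = a x * ((‖v x‖ ^ 2 : ℝ) : ℂ) := by
    intro x
    have : u x * starRingEnd ℂ (v x) = v x * starRingEnd ℂ (v x) := by
      simp only [hv, Set.indicator_apply]
      split_ifs <;> simp
    rw [mul_left_comm, this, Complex.mul_conj']
    simp
  have hofReal : ∀ y, ENNReal.ofReal (‖v y‖ ^ 2) = ‖v y‖ₑ ^ 2 := fun y => by
    rw [ENNReal.ofReal_pow (norm_nonneg _), ofReal_norm]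
  have hvc : IsConditionable m μ fun x => ((‖v x‖ ^ 2 : ℝ) : ℂ) := by
    refine ⟨Complex.measurable_ofReal.comp_aemeasurable (vm.norm.pow_const 2), ?_⟩
    have e : (fun y => ‖((‖v y‖ ^ 2 : ℝ) : ℂ)‖ₑ) = fun y => ‖v y‖ₑ ^ 2 := by
      funext y
      rw [← hofReal, ← ofReal_norm, Complex.norm_real, Real.norm_of_nonneg (by positivity)]
    rw [e]
    filter_upwards [hQg] with x hx using hx.1
  have fm : AEMeasurable (fun x => a x * starRingEnd ℂ (v x)) μ :=
    (am.mono hm le_rfl).aemeasurable.mul (Complex.continuous_conj.measurable.comp_aemeasurable vm)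
  have fint : ∫⁻ x, ‖a x * starRingEnd ℂ (v x)‖ₑ ^ 2 ∂μ ≤
      ∫⁻ x, ‖g x‖ₑ ^ 2 * (U x)⁻¹ ∂μ + ε := by
    refine le_trans (le_of_eq_of_le ?_
      (lintegral_mono_ae (f := fun x => ‖a x‖ₑ ^ 2 * Q x) (g := κ) ?_)) κint
    · rw [lintegral_mul_condLExp (t := fun x => ‖a x‖ₑ ^ 2) hm
        ((measurable_enorm.comp am).pow_const 2) (vm.enorm.pow_const 2)]
      refine lintegral_congr fun x => ?_
      rw [enorm_mul, RCLike.enorm_conj, mul_pow]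
    · filter_upwards [hQg] with x ⟨h1, h2⟩
      rcases eq_or_ne (Q x) 0 with h0 | h0
      · simp [h0]
      · have e : ‖a x‖ₑ = ‖g x‖ₑ * (Q x)⁻¹ := by
          simp only [ha]
          rw [enorm_mul, ← ofReal_norm (((Q x).toReal⁻¹ : ℝ) : ℂ), Complex.norm_real,
            Real.norm_of_nonneg (by positivity), ENNReal.ofReal_inv_of_pos
            (ENNReal.toReal_pos h0 h1.ne), ENNReal.ofReal_toReal h1.ne]
        rw [e, mul_pow, mul_assoc, sq (Q x)⁻¹, mul_assoc, ENNReal.inv_mul_cancel h0 h1.ne, mul_one,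
          ← div_eq_mul_inv]
        exact ENNReal.div_le_of_le_mul' h2
  refine ⟨fun x => a x * starRingEnd ℂ (v x), ⟨fm.aestronglyMeasurable, ?_⟩, ?_, ?_, fint⟩
  · rw [eLpNorm_lt_top_iff_lintegral_rpow_enorm_lt_top two_ne_zero ENNReal.ofNat_ne_top]
    simp only [ENNReal.toReal_ofNat, ENNReal.rpow_ofNat]
    exact fint.trans_lt (ENNReal.add_lt_top.2 ⟨hgu.lt_top, hε'.lt_top⟩)
  · simp only [huv]
    exact isConditionable_mul hm am hvc
  · simp only [huv]
    filter_upwards [complexCondExp_mul_of_measurable hm am hvc, hQg] with x h1 ⟨h2, h3⟩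
    rw [h1, complexCondExp_ofReal (fun x => by positivity)]
    simp only [hofReal]
    change a x * ((Q x).toReal : ℂ) = g x
    simp only [ha]
    rcases eq_or_ne (Q x) 0 with h0 | h0
    · rw [h0, zero_mul, nonpos_iff_eq_zero, pow_eq_zero_iff two_ne_zero, enorm_eq_zero] at h3
      simp [h3]
    · have : ((Q x).toReal : ℂ) ≠ 0 := by
        exact_mod_cast (ENNReal.toReal_pos h0 h2.ne).ne'
      rw [Complex.ofReal_inv, mul_assoc, inv_mul_cancel₀ this, mul_one]

end WCTaux

namespace MeasureTheory

variable {X : Type*} {m0 : MeasurableSpace X} {μ : Measure X}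

theorem memLp_two_iff_lintegral_enorm_sq {f : X → ℂ} (hf : AEStronglyMeasurable f μ) :
    MemLp f 2 μ ↔ ∫⁻ x, ‖f x‖ₑ ^ 2 ∂μ ≠ ∞ := by
  rw [MemLp, eLpNorm_lt_top_iff_lintegral_rpow_enorm_lt_top two_ne_zero ENNReal.ofNat_ne_top]
  simp [hf, lt_top_iff_ne_top]

theorem MemLp.lintegral_enorm_sq_ne_top {f : X → ℂ} (hf : MemLp f 2 μ) :
    ∫⁻ x, ‖f x‖ₑ ^ 2 ∂μ ≠ ∞ :=
  (memLp_two_iff_lintegral_enorm_sq hf.1).1 hf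

/-- If `F` is essentially unbounded, then some integrable weight `k` has `∫ k F = ∞`. -/
theorem exists_lintegral_mul_eq_top [SigmaFinite μ] {F : X → ℝ≥0∞} (hF : Measurable F)
    (h : ∀ n : ℕ, μ {x | 2 ^ n < F x} ≠ 0) :
    ∃ k : X → ℝ≥0∞, Measurable k ∧ ∫⁻ x, k x ∂μ ≠ ∞ ∧ ∫⁻ x, k x * F x ∂μ = ∞ ∧
      ∀ x, k x ≠ 0 → F x ≠ 0 := by
  have hC : ∀ n : ℕ, ∃ C ⊆ {x | 2 ^ n < F x}, MeasurableSet C ∧ μ C ≠ 0 ∧ μ C ≠ ∞ := by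
    intro n
    obtain ⟨C, hC, hC', h1, h2⟩ := Measure.exists_subset_measure_lt_top (r := 0)
      (measurableSet_lt measurable_const hF) (pos_iff_ne_zero.2 (h n))
    exact ⟨C, hC', hC, h1.ne', h2.ne⟩
  choose C hCF Cm C0 Ct using hC
  have tm : ∀ n, Measurable ((C n).indicator fun _ => (2 ^ n : ℝ≥0∞)⁻¹ * (μ (C n))⁻¹) :=
    fun n => measurable_const.indicator (Cm n)
  -- The `n`-th term has integral `2⁻ⁿ`, but contributes at least `1` against `F`, since `F > 2ⁿ` on
  -- `C n`.
  refine ⟨fun x => ∑' n, (C n).indicator (fun _ => (2 ^ n : ℝ≥0∞)⁻¹ * (μ (C n))⁻¹) x,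
    Measurable.tsum tm, ?_, ?_, ?_⟩
  · rw [lintegral_tsum fun n => (tm n).aemeasurable]
    simp only [lintegral_indicator_const (Cm _), mul_assoc, ENNReal.inv_mul_cancel (C0 _) (Ct _),
      mul_one, ENNReal.inv_pow]
    rw [ENNReal.tsum_geometric]
    simp
  · simp only [← ENNReal.tsum_mul_right]
    rw [lintegral_tsum (f := fun n x => (C n).indicator (fun _ => (2 ^ n : ℝ≥0∞)⁻¹ *
      (μ (C n))⁻¹) x * F x) fun n => ((tm n).mul hF).aemeasurable, eq_top_iff,
      ← ENNReal.tsum_const_eq_top_of_ne_zero (α := ℕ) one_ne_zero]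
    refine ENNReal.tsum_le_tsum fun n => ?_
    calc (1 : ℝ≥0∞) = ∫⁻ x, (C n).indicator (fun _ => (μ (C n))⁻¹) x ∂μ := by
          rw [lintegral_indicator_const (Cm n), ENNReal.inv_mul_cancel (C0 n) (Ct n)]
      _ ≤ _ := by
          refine lintegral_mono fun x => ?_
          by_cases hx : x ∈ C n
          · simp only [Set.indicator_of_mem hx]
            have h1 : (2 ^ n : ℝ≥0∞) ≤ F x := (hCF n hx).le
            calc (μ (C n))⁻¹ = (2 ^ n : ℝ≥0∞)⁻¹ * (μ (C n))⁻¹ * 2 ^ n := by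
                  rw [mul_right_comm, ENNReal.inv_mul_cancel (by simp) (by simp), one_mul]
              _ ≤ _ := by gcongr
          · simp [Set.indicator_of_notMem hx]
  · intro x hx h0
    refine hx (ENNReal.tsum_eq_zero.2 fun n => Set.indicator_of_notMem (fun hn => ?_) _)
    have := hCF n hn
    simp [h0] at this

end MeasureTheory

/-! ### The range of the operator and its closedness -/

namespace WCTaux

variable {X : Type*} {m m0 : MeasurableSpace X} {μ : Measure X} {u w : X → ℂ}

theorem coeFn_wctOperator (f : (wctOperator m μ u w).domain) :
    wctOperator m μ u w f =ᵐ[μ] fun x => w x * complexCondExp m μ (fun y => u y * f.1 y) x :=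
  f.2.2.coeFn_toLp

theorem toLp_mem_domain {f g : X → ℂ} (hf : MemLp f 2 μ)
    (huf : IsConditionable m μ fun x => u x * f x)
    (hg : complexCondExp m μ (fun x => u x * f x) =ᵐ[μ] g) (hwg : MemLp (fun x => w x * g x) 2 μ) :
    ∃ h : hf.toLp ∈ (wctOperator m μ u w).domain,
      wctOperator m μ u w ⟨hf.toLp, h⟩ =ᵐ[μ] fun x => w x * g x := by
  have e : (fun x => u x * f x) =ᵐ[μ] fun x => u x * hf.toLp f x := by
    filter_upwards [hf.coeFn_toLp] with x hx
    rw [hx]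
  have e2 : (fun x => w x * g x) =ᵐ[μ]
      fun x => w x * complexCondExp m μ (fun y => u y * hf.toLp f y) x := by
    filter_upwards [complexCondExp_congr (m := m) e, hg] with x h1 h2
    rw [← h1, h2]
  exact ⟨⟨huf.congr e, hwg.ae_eq e2⟩, (coeFn_wctOperator _).trans e2.symm⟩

/-- With `g = E(uf)` one direction is Cauchy–Schwarz; the other solves `E(uf) = g`. All that remains
of `f` is a weighted integrability condition on `g`. -/
theorem mem_range_wctOperator (hm : m ≤ m0) [SigmaFinite (μ.trim hm)] (hu : AEMeasurable u μ)
    (h : Lp ℂ 2 μ) :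
    h ∈ Set.range (wctOperator m μ u w) ↔ ∃ g : X → ℂ, Measurable[m] g ∧
      h =ᵐ[μ] (fun x => w x * g x) ∧
      ∫⁻ x, ‖g x‖ₑ ^ 2 * (condLExp m μ (fun y => ‖u y‖ₑ ^ 2) x)⁻¹ ∂μ ≠ ∞ := by
  constructor
  · rintro ⟨f, rfl⟩
    refine ⟨_, measurable_complexCondExp _, coeFn_wctOperator f, ?_⟩
    refine ((lintegral_mono_ae (enorm_complexCondExp_mul_sq_mul_inv_le hm hu
      (Lp.memLp f.1).1.aemeasurable f.2.1)).trans_lt ?_).ne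
    rw [lintegral_condLExp hm]
    exact (Lp.memLp f.1).lintegral_enorm_sq_ne_top.lt_top
  · rintro ⟨g, gm, hg, hgu⟩
    obtain ⟨f, hf, huf, hfg, -⟩ := exists_complexCondExp_mul_eq hm hu gm hgu one_ne_zero
      ENNReal.one_ne_top
    obtain ⟨hd, he⟩ := toLp_mem_domain hf huf hfg ((Lp.memLp h).ae_eq hg)
    exact ⟨_, Lp.ext (he.trans hg.symm)⟩

theorem lintegral_enorm_mul_sq (hm : m ≤ m0) [SigmaFinite (μ.trim hm)] (hw : AEMeasurable w μ)
    {g : X → ℂ} (hg : Measurable[m] g) :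
    ∫⁻ x, ‖w x * g x‖ₑ ^ 2 ∂μ =
      ∫⁻ x, ‖g x‖ₑ ^ 2 * condLExp m μ (fun y => ‖w y‖ₑ ^ 2) x ∂μ := by
  rw [lintegral_mul_condLExp (t := fun x => ‖g x‖ₑ ^ 2) hm
    ((measurable_enorm.comp hg).pow_const 2) (hw.enorm.pow_const 2)]
  refine lintegral_congr fun x => ?_
  rw [enorm_mul, mul_pow, mul_comm]

/-- The limit is again of the form `w G`, and `∫ |G|² W < ∞` because it is in `L²`; the lower bound
on `UW` then gives `|G|²/U ≤ |G|² W / r`. -/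
theorem isClosed_range_of_le (hm : m ≤ m0) [SigmaFinite (μ.trim hm)] (hu : AEMeasurable u μ)
    (hw : AEMeasurable w μ) {r : ℝ≥0∞} (hr : r ≠ 0) (hr' : r ≠ ∞)
    (h : ∀ᵐ x ∂μ, condLExp m μ (fun y => ‖u y‖ₑ ^ 2) x ≠ 0 →
      condLExp m μ (fun y => ‖w y‖ₑ ^ 2) x ≠ 0 →
      r ≤ condLExp m μ (fun y => ‖u y‖ₑ ^ 2) x * condLExp m μ (fun y => ‖w y‖ₑ ^ 2) x) :
    IsClosed (Set.range (wctOperator m μ u w)) := by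
  set U := condLExp m μ (fun y => ‖u y‖ₑ ^ 2) with hU
  set W := condLExp m μ (fun y => ‖w y‖ₑ ^ 2) with hW
  have Um : Measurable[m] U := measurable_condLExp _ _ _
  have Wm : Measurable[m] W := measurable_condLExp _ _ _
  refine isClosed_of_closure_subset fun f hf => ?_
  obtain ⟨F, hF, hlim⟩ := mem_closure_iff_seq_limit.1 hf
  obtain ⟨ns, -, hns⟩ := (tendstoInMeasure_of_tendsto_Lp hlim).exists_seq_tendsto_ae
  simp only [mem_range_wctOperator hm hu] at hF
  choose g gm hFg hgu using hF
  -- Dividing the limit `f` by `w` would not give a function measurable for the subalgebra. Instead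
  -- `G` is the pointwise limit of the `g (ns i)` on their convergence set inside `S`, and `0`
  -- elsewhere.
  set L : Set X := {x | ∃ c, Filter.Tendsto (fun i => g (ns i) x) Filter.atTop (nhds c)} ∩
    ({x | U x = 0}ᶜ ∩ {x | W x = 0}ᶜ) with hL
  have Lm : MeasurableSet[m] L :=
    (@measurableSet_exists_tendsto _ _ _ m _ _ _ _ _ _ _ _ _ fun i => gm (ns i)).inter
      ((Um (measurableSet_singleton 0)).compl.inter (Wm (measurableSet_singleton 0)).compl)
  have hex : ∀ x, ∃ c, Filter.Tendsto (fun i => L.indicator (g (ns i)) x) Filter.atTop (nhds c) := by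
    intro x
    by_cases hx : x ∈ L
    · obtain ⟨c, hc⟩ := hx.1
      exact ⟨c, by simpa only [Set.indicator_of_mem hx] using hc⟩
    · simp only [Set.indicator_of_notMem hx]
      exact ⟨0, tendsto_const_nhds⟩
  choose G hG using hex
  have Gm : Measurable[m] G := @measurable_of_tendsto_metrizable _ _ m _ _ _ _ _ _
    (fun i => (gm (ns i)).indicator Lm) (tendsto_pi_nhds.2 hG)
  have hG0 : ∀ x, U x = 0 ∨ W x = 0 → G x = 0 := by
    intro x hx
    have hx' : x ∉ L := fun hxL => hx.elim hxL.2.1 hxL.2.2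
    have := hG x
    simp only [Set.indicator_of_notMem hx'] at this
    exact tendsto_nhds_unique this tendsto_const_nhds
  have hgfin : ∀ᵐ x ∂μ, ∀ i, U x = 0 → g i x = 0 := by
    refine ae_all_iff.2 fun i => ?_
    filter_upwards [ae_lt_top ((((measurable_enorm.comp (gm i)).pow_const 2).mul Um.inv).mono hm
      le_rfl) (hgu i)] with x hx h0
    by_contra hne
    simp [h0, ENNReal.mul_top, hne] at hx
  -- Where `w = 0`, or where `U = 0` and hence every `g i` vanishes, both sides are `0`. At almost
  -- every other point `W ≠ 0` and `g (ns i)` converges to `f / w`, so the point lies in `L`.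
  have hfG : f =ᵐ[μ] fun x => w x * G x := by
    filter_upwards [hns, ae_all_iff.2 hFg, hgfin,
      ae_eq_zero_of_condLExp_eq_zero hm (hw.enorm.pow_const 2)] with x h1 h2 h3 h4
    simp only [h2] at h1
    rcases eq_or_ne (w x) 0 with h0 | h0
    · simp only [h0, zero_mul] at h1 ⊢
      exact tendsto_nhds_unique h1 tendsto_const_nhds
    rcases eq_or_ne (U x) 0 with hU0 | hU0
    · simp only [h3 _ hU0, mul_zero] at h1
      rw [hG0 x (Or.inl hU0), mul_zero]
      exact tendsto_nhds_unique h1 tendsto_const_nhds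
    have hW0 : W x ≠ 0 := fun h5 => h0 (by simpa using h4 h5)
    have h5 : Filter.Tendsto (fun i => g (ns i) x) Filter.atTop (nhds ((w x)⁻¹ * f x)) := by
      simpa only [inv_mul_cancel_left₀ h0] using h1.const_mul (w x)⁻¹
    have hxL : x ∈ L := ⟨⟨_, h5⟩, hU0, hW0⟩
    have h6 := hG x
    simp only [Set.indicator_of_mem hxL] at h6
    exact tendsto_nhds_unique h1 (h6.const_mul (w x))
  refine (mem_range_wctOperator hm hu f).2 ⟨G, Gm, hfG, ?_⟩
  have hint : ∫⁻ x, ‖G x‖ₑ ^ 2 * W x ∂μ ≠ ∞ := by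
    rw [← lintegral_enorm_mul_sq hm hw Gm]
    exact ((Lp.memLp f).ae_eq hfG).lintegral_enorm_sq_ne_top
  refine ((lintegral_mono_ae (g := fun x => ‖G x‖ₑ ^ 2 * W x * r⁻¹) ?_).trans_lt ?_).ne
  · filter_upwards [h] with x hx
    by_cases h0 : U x = 0 ∨ W x = 0
    · simp [hG0 x h0]
    rw [not_or] at h0
    have : (U x)⁻¹ ≤ W x * r⁻¹ := by
      rcases eq_or_ne (U x) ∞ with h1 | h1
      · simp [h1]
      calc (U x)⁻¹ = (U x)⁻¹ * (r * r⁻¹) := by rw [ENNReal.mul_inv_cancel hr hr', mul_one]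
        _ ≤ (U x)⁻¹ * ((U x * W x) * r⁻¹) := by gcongr; exact hx h0.1 h0.2
        _ = W x * r⁻¹ := by
          rw [← mul_assoc, ← mul_assoc, ENNReal.inv_mul_cancel h0.1 h1, one_mul]
    rw [mul_assoc]
    gcongr
  · rw [lintegral_mul_const' _ _ (ENNReal.inv_ne_top.2 hr)]
    exact ENNReal.mul_lt_top hint.lt_top (ENNReal.inv_lt_top.2 (pos_iff_ne_zero.2 hr))

end WCTaux

namespace MeasureTheory

variable {X : Type*} {m0 : MeasurableSpace X} {μ : Measure X}

theorem tendsto_toLp_indicator {h : X → ℂ} (hh : MemLp h 2 μ) {s : ℕ → Set X}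
    (hs : ∀ n, MeasurableSet (s n)) (hlim : ∀ᵐ x ∂μ, ∀ᶠ n in Filter.atTop, x ∈ s n) :
    Filter.Tendsto (fun n => (hh.indicator (hs n)).toLp) Filter.atTop (nhds hh.toLp) := by
  rw [Lp.tendsto_Lp_iff_tendsto_eLpNorm'']
  simp only [eLpNorm_eq_lintegral_rpow_enorm_toReal two_ne_zero ENNReal.ofNat_ne_top,
    ENNReal.toReal_ofNat, ENNReal.rpow_ofNat]
  have key : Filter.Tendsto (fun n => ∫⁻ x, ‖((s n).indicator h - h) x‖ₑ ^ 2 ∂μ) Filter.atTop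
      (nhds (∫⁻ _, 0 ∂μ)) := by
    refine tendsto_lintegral_of_dominated_convergence' (fun x => ‖h x‖ₑ ^ 2)
      (fun n => ((hh.indicator (hs n)).sub hh).1.enorm.pow_const 2)
      (fun n => Filter.Eventually.of_forall fun x => ?_) hh.lintegral_enorm_sq_ne_top ?_
    · by_cases hx : x ∈ s n <;> simp [hx]
    · filter_upwards [hlim] with x hx
      refine tendsto_const_nhds.congr' ?_
      filter_upwards [hx] with n hn
      simp [hn]
  rw [lintegral_zero] at key
  exact (ENNReal.continuous_rpow_const (y := 1 / 2)).tendsto' 0 0 (by simp) |>.comp key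

end MeasureTheory

namespace WCTaux

variable {X : Type*} {m m0 : MeasurableSpace X} {μ : Measure X} {u w : X → ℂ}

/-- Although `w` may vanish at points where `W ≠ 0`, the identity `∫ |w (g - g')|² = ∫ |g - g'|² W`
determines `g` wherever `W ≠ 0`. -/
theorem ae_eq_of_mul_ae_eq (hm : m ≤ m0) [SigmaFinite (μ.trim hm)] (hw : AEMeasurable w μ)
    {g g' : X → ℂ} (hg : Measurable[m] g) (hg' : Measurable[m] g')
    (h : (fun x => w x * g x) =ᵐ[μ] fun x => w x * g' x) :
    ∀ᵐ x ∂μ, condLExp m μ (fun y => ‖w y‖ₑ ^ 2) x ≠ 0 → g x = g' x := by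
  have hd : Measurable[m] fun x => g x - g' x := hg.sub hg'
  have h1 := lintegral_enorm_mul_sq hm hw hd
  have h2 : ∫⁻ x, ‖w x * (g x - g' x)‖ₑ ^ 2 ∂μ = 0 := by
    rw [lintegral_congr_ae (g := fun _ => 0), lintegral_zero]
    filter_upwards [h] with x hx
    simp [mul_sub, hx]
  rw [h2, eq_comm, lintegral_eq_zero_iff] at h1
  · filter_upwards [h1] with x hx hW
    have := (mul_eq_zero.1 hx).resolve_right hW
    rwa [pow_eq_zero_iff two_ne_zero, enorm_eq_zero, sub_eq_zero] at this
  · exact (((measurable_enorm.comp hd).pow_const 2).mul (measurable_condLExp m μ _)).mono hm le_rfl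

/-- If no `r` works, `F = 1/(UW)` is essentially unbounded on `S`, so there is `k` with `∫ k < ∞ = ∫
k F`. For `g = √(k/W)` the function `w g` is in `L²` but outside the range, while its restrictions
to `{F ≤ n}` lie in the range and converge to it. -/
theorem exists_le_of_isClosed_range (hm : m ≤ m0) [SigmaFinite (μ.trim hm)]
    (hu : AEMeasurable u μ) (hw : AEMeasurable w μ)
    (hcl : IsClosed (Set.range (wctOperator m μ u w))) :
    ∃ r : ℝ, 0 < r ∧ ∀ᵐ x ∂μ, condLExp m μ (fun y => ‖u y‖ₑ ^ 2) x ≠ 0 →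
      condLExp m μ (fun y => ‖w y‖ₑ ^ 2) x ≠ 0 → ENNReal.ofReal r ≤
        condLExp m μ (fun y => ‖u y‖ₑ ^ 2) x * condLExp m μ (fun y => ‖w y‖ₑ ^ 2) x := by
  by_contra! hcon
  set U := condLExp m μ (fun y => ‖u y‖ₑ ^ 2) with hU
  set W := condLExp m μ (fun y => ‖w y‖ₑ ^ 2) with hW
  have Um : Measurable[m] U := measurable_condLExp _ _ _
  have Wm : Measurable[m] W := measurable_condLExp _ _ _
  set S : Set X := {x | U x = 0}ᶜ ∩ {x | W x = 0}ᶜ with hS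
  have Sm : MeasurableSet[m] S :=
    (Um (measurableSet_singleton 0)).compl.inter (Wm (measurableSet_singleton 0)).compl
  set F : X → ℝ≥0∞ := S.indicator fun x => (U x * W x)⁻¹ with hF
  have Fm : Measurable[m] F := (Um.mul Wm).inv.indicator Sm
  have Ftop : ∀ x, F x ≠ ∞ := by
    intro x
    simp only [hF, Set.indicator_apply]
    split_ifs with h
    · exact ENNReal.inv_ne_top.2 (mul_ne_zero h.1 h.2)
    · exact ENNReal.zero_ne_top
  obtain ⟨k, km, kint, kF, k0⟩ := @exists_lintegral_mul_eq_top X m (μ.trim hm) _ F Fm (by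
    intro n hn
    have := hcon (((2 : ℝ) ^ n)⁻¹) (by positivity)
    have hn' : ∀ᵐ x ∂μ, ¬ 2 ^ n < F x := by
      rw [ae_iff]
      simpa only [not_not] using measure_eq_zero_of_trim_eq_zero hm hn
    obtain ⟨x, ⟨h1, h2, h3⟩, hx⟩ := (this.and_eventually hn').exists
    refine hx ?_
    have hxS : x ∈ S := ⟨h1, h2⟩
    change 2 ^ n < F x
    simp only [hF, Set.indicator_of_mem hxS]
    rw [ENNReal.ofReal_inv_of_pos (by positivity), ENNReal.ofReal_pow (by norm_num),
      ENNReal.ofReal_ofNat] at h3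
    exact ENNReal.lt_inv_iff_lt_inv.1 h3)
  rw [lintegral_trim hm km] at kint
  rw [lintegral_trim (f := fun x => k x * F x) hm (km.mul Fm)] at kF
  -- `k` lives where `F ≠ 0`; there `UW` is finite and both factors are nonzero, hence both are
  -- finite.
  have kS : ∀ x, k x ≠ 0 → U x ≠ 0 ∧ W x ≠ 0 ∧ U x ≠ ∞ ∧ W x ≠ ∞ := by
    intro x hx
    have hFx := k0 x hx
    have hxS : x ∈ S := by
      by_contra h
      exact hFx (Set.indicator_of_notMem h _)
    simp only [hF, Set.indicator_of_mem hxS, ne_eq, ENNReal.inv_eq_zero, ENNReal.mul_eq_top,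
      not_or, not_and, not_not] at hFx
    have h1 : U x ≠ 0 := hxS.1
    have h2 : W x ≠ 0 := hxS.2
    exact ⟨h1, h2, fun h => h2 (hFx.2 h), fun h => hFx.1 h1 h⟩
  set g : X → ℂ := fun x => (Real.sqrt (k x * (W x)⁻¹).toReal : ℂ) with hg
  have gm : Measurable[m] g :=
    Complex.measurable_ofReal.comp (Real.continuous_sqrt.measurable.comp
      (km.mul Wm.inv).ennreal_toReal)
  have kfin : ∀ᵐ x ∂μ, k x < ∞ := ae_lt_top (km.mono hm le_rfl) kint
  have gsq : ∀ᵐ x ∂μ, ‖g x‖ₑ ^ 2 = k x * (W x)⁻¹ := by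
    filter_upwards [kfin] with x hx
    have hne : k x * (W x)⁻¹ ≠ ∞ := by
      rcases eq_or_ne (k x) 0 with h | h
      · simp [h]
      · exact ENNReal.mul_ne_top hx.ne (ENNReal.inv_ne_top.2 (kS x h).2.1)
    rw [← ofReal_norm, Complex.norm_real, Real.norm_of_nonneg (Real.sqrt_nonneg _),
      ← ENNReal.ofReal_pow (Real.sqrt_nonneg _), Real.sq_sqrt ENNReal.toReal_nonneg,
      ENNReal.ofReal_toReal hne]
  have gW : ∀ᵐ x ∂μ, ‖g x‖ₑ ^ 2 * W x = k x := by
    filter_upwards [gsq] with x hx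
    rw [hx]
    rcases eq_or_ne (k x) 0 with h | h
    · simp [h]
    · rw [mul_assoc, ENNReal.inv_mul_cancel (kS x h).2.1 (kS x h).2.2.2, mul_one]
  have gU : ∀ᵐ x ∂μ, ‖g x‖ₑ ^ 2 * (U x)⁻¹ = k x * F x := by
    filter_upwards [gsq] with x hx
    rw [hx]
    rcases eq_or_ne (k x) 0 with h | h
    · simp [h]
    · have hxS : x ∈ S := ⟨(kS x h).1, (kS x h).2.1⟩
      simp only [hF, Set.indicator_of_mem hxS]
      rw [ENNReal.mul_inv (Or.inl (kS x h).1) (Or.inl (kS x h).2.2.1), mul_assoc, mul_comm (W x)⁻¹]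
  have hwg : MemLp (fun x => w x * g x) 2 μ := by
    rw [memLp_two_iff_lintegral_enorm_sq (f := fun x => w x * g x)
      (hw.mul (gm.mono hm le_rfl).aemeasurable).aestronglyMeasurable,
      lintegral_enorm_mul_sq hm hw gm, lintegral_congr_ae gW]
    exact kint
  have sm : ∀ n : ℕ, MeasurableSet[m] {x | F x ≤ n} := fun n =>
    measurableSet_le (mδ := m) Fm (@measurable_const _ _ _ m _)
  have hmem : hwg.toLp ∈ Set.range (wctOperator m μ u w) := by
    refine hcl.mem_of_tendsto (tendsto_toLp_indicator hwg (fun n => hm _ (sm n))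
      (Filter.Eventually.of_forall fun x => ?_)) (Filter.Eventually.of_forall fun n => ?_)
    · obtain ⟨n, hn⟩ := ENNReal.exists_nat_gt (Ftop x)
      filter_upwards [Filter.eventually_ge_atTop n] with k hk
      exact hn.le.trans (by exact_mod_cast hk)
    · refine (mem_range_wctOperator hm hu _).2 ⟨{x | F x ≤ n}.indicator g, gm.indicator (sm n),
        (MemLp.coeFn_toLp _).trans (Filter.Eventually.of_forall fun x => ?_), ?_⟩
      · exact Set.indicator_mul_right _ w g
      · refine ((lintegral_mono_ae (g := fun x => k x * n) ?_).trans_lt ?_).ne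
        · filter_upwards [gU] with x hx
          by_cases h : F x ≤ n
          · have : x ∈ {x | F x ≤ n} := h
            rw [Set.indicator_of_mem this, hx]
            gcongr
          · have : x ∉ {x | F x ≤ n} := h
            rw [Set.indicator_of_notMem this]
            simp
        · rw [lintegral_mul_const _ (km.mono hm le_rfl)]
          exact ENNReal.mul_lt_top kint.lt_top (ENNReal.natCast_lt_top n)
  obtain ⟨g', gm', hg', hint⟩ := (mem_range_wctOperator hm hu _).1 hmem
  -- Any other representation `w g'` has `g' = g` where `W ≠ 0`, in particular where `k ≠ 0`, so its
  -- `1/U`-norm is infinite too.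
  refine hint (eq_top_iff.2 (kF.symm.le.trans (lintegral_mono_ae ?_)))
  filter_upwards [gU, ae_eq_of_mul_ae_eq hm hw gm gm' (hwg.coeFn_toLp.symm.trans hg')] with x h1 h2
  rcases eq_or_ne (k x) 0 with h | h
  · simp [h]
  · rw [← h1, h2 (kS x h).2.1]

theorem isClosed_range_wctOperator_iff (hm : m ≤ m0) [SigmaFinite (μ.trim hm)]
    (hu : AEMeasurable u μ) (hw : AEMeasurable w μ) :
    IsClosed (Set.range (wctOperator m μ u w)) ↔
      ∃ r : ℝ, 0 < r ∧ ∀ᵐ x ∂μ, condLExp m μ (fun y => ‖u y‖ₑ ^ 2) x ≠ 0 →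
        condLExp m μ (fun y => ‖w y‖ₑ ^ 2) x ≠ 0 → ENNReal.ofReal r ≤
          condLExp m μ (fun y => ‖u y‖ₑ ^ 2) x * condLExp m μ (fun y => ‖w y‖ₑ ^ 2) x :=
  ⟨exists_le_of_isClosed_range hm hu hw, fun ⟨_, hr, h⟩ =>
    isClosed_range_of_le hm hu hw (ENNReal.ofReal_pos.2 hr).ne' ENNReal.ofReal_ne_top h⟩

end WCTaux

/-! ### The range of the adjoint -/

namespace WCTaux

variable {X : Type*} {m m0 : MeasurableSpace X} {μ : Measure X} {u w : X → ℂ}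

theorem _root_.IsConditionable.conj {f : X → ℂ} (hf : IsConditionable m μ f) :
    IsConditionable m μ fun x => starRingEnd ℂ (f x) := by
  refine ⟨Complex.continuous_conj.measurable.comp_aemeasurable hf.1, ?_⟩
  simpa only [RCLike.enorm_conj] using hf.2

theorem measurable_conj_comp {a : X → ℂ} (ha : Measurable[m] a) :
    Measurable[m] fun x => starRingEnd ℂ (a x) :=
  Complex.continuous_conj.measurable.comp ha

theorem complexCondExp_mul_toLp {f : X → ℂ} (hf : MemLp f 2 μ) :
    complexCondExp m μ (fun x => u x * hf.toLp f x) =ᵐ[μ]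
      complexCondExp m μ (fun x => u x * f x) := by
  refine complexCondExp_congr ?_
  filter_upwards [hf.coeFn_toLp] with x hx
  rw [hx]

/-- The factor `E(ux)` is measurable for the subalgebra, so the other factor of the pairing may be
replaced by its conditional expectation. The result is symmetric in the two operators, which yields
formal adjointness. -/
theorem inner_wctOperator (hm : m ≤ m0) [SigmaFinite (μ.trim hm)]
    (x : (wctOperator m μ u w).domain) (f : Lp ℂ 2 μ)
    (hf : IsConditionable m μ fun t => starRingEnd ℂ (w t) * f t) :
    inner ℂ f (wctOperator m μ u w x) = ∫ t, complexCondExp m μ (fun s => u s * x.1 s) t *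
      starRingEnd ℂ (complexCondExp m μ (fun s => starRingEnd ℂ (w s) * f s) t) ∂μ := by
  have e : ∀ᵐ t ∂μ, inner ℂ (f t) (wctOperator m μ u w x t) =
      complexCondExp m μ (fun s => u s * x.1 s) t *
        starRingEnd ℂ (starRingEnd ℂ (w t) * f t) := by
    filter_upwards [coeFn_wctOperator x] with t ht
    rw [ht, RCLike.inner_apply, map_mul, Complex.conj_conj]
    ring
  have hint := (L2.integrable_inner (𝕜 := ℂ) f (wctOperator m μ u w x)).congr e
  rw [L2.inner_def, integral_congr_ae e,
    ← integral_mul_complexCondExp hm (measurable_complexCondExp _) hf.conj hint]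
  simp only [complexCondExp_conj]

theorem isFormalAdjoint_wctOperator (hm : m ≤ m0) [SigmaFinite (μ.trim hm)] :
    (wctOperator m μ u w).IsFormalAdjoint
      (wctOperator m μ (fun x => starRingEnd ℂ (w x)) fun x => starRingEnd ℂ (u x)) := by
  intro x y
  have h2 := inner_wctOperator hm y x.1 (by simpa only [Complex.conj_conj] using x.2.1)
  rw [← inner_conj_symm, inner_wctOperator hm x y.1 y.2.1, h2, ← integral_conj]
  simp only [map_mul, Complex.conj_conj, mul_comm]

theorem mul_mem_domain (hm : m ≤ m0) [SigmaFinite (μ.trim hm)]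
    (x : (wctOperator m μ u w).domain) {c : X → ℂ} (hc : Measurable[m] c) (hc1 : ∀ t, ‖c t‖ ≤ 1) :
    ∃ h : MemLp (fun t => c t * x.1 t) 2 μ, h.toLp ∈ (wctOperator m μ u w).domain ∧
      complexCondExp m μ (fun t => u t * h.toLp (fun t => c t * x.1 t) t) =ᵐ[μ]
        fun t => c t * complexCondExp m μ (fun s => u s * x.1 s) t := by
  have hcm : AEStronglyMeasurable c μ := (hc.mono hm le_rfl).aestronglyMeasurable
  have hle : ∀ {f : X → ℂ}, MemLp f 2 μ → MemLp (fun t => c t * f t) 2 μ := fun {f} hf =>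
    hf.of_le (hcm.mul hf.1) (Filter.Eventually.of_forall fun t => by
      rw [norm_mul]; exact mul_le_of_le_one_left (norm_nonneg _) (hc1 t))
  have e := complexCondExp_mul_of_measurable hm hc x.2.1
  have e1 : (fun t => u t * (c t * x.1 t)) = fun t => c t * (u t * x.1 t) := by
    funext t; ring
  have hcond : IsConditionable m μ fun t => u t * (c t * x.1 t) := by
    rw [e1]
    exact isConditionable_mul hm hc x.2.1
  rw [← e1] at e
  have hwg : MemLp (fun t => w t * (c t * complexCondExp m μ (fun s => u s * x.1 s) t)) 2 μ := by
    simpa only [mul_left_comm] using hle x.2.2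
  exact ⟨hle (Lp.memLp x.1), (toLp_mem_domain (hle (Lp.memLp x.1)) hcond e hwg).1,
    (complexCondExp_mul_toLp _).trans e⟩

theorem norm_toLp_le {f : X → ℂ} (hf : MemLp f 2 μ) {δ : ℝ} (hδ : 0 ≤ δ)
    (h : ∫⁻ t, ‖f t‖ₑ ^ 2 ∂μ ≤ ENNReal.ofReal (δ ^ 2)) : ‖hf.toLp‖ ≤ δ := by
  rw [Lp.norm_toLp]
  refine ENNReal.toReal_le_of_le_ofReal hδ ?_
  rw [eLpNorm_eq_lintegral_rpow_enorm_toReal two_ne_zero ENNReal.ofNat_ne_top]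
  simp only [ENNReal.toReal_ofNat, ENNReal.rpow_ofNat]
  calc (∫⁻ t, ‖f t‖ₑ ^ 2 ∂μ) ^ (1 / 2 : ℝ) ≤ (ENNReal.ofReal (δ ^ 2)) ^ (1 / 2 : ℝ) := by gcongr
    _ = ENNReal.ofReal δ := by
      rw [ENNReal.ofReal_rpow_of_nonneg (by positivity) (by norm_num), ← Real.sqrt_eq_rpow,
        Real.sqrt_sq hδ]

/-- Used with `A = |a|²` and `V = W` or `V = U`: damping by `q` makes `q |a|²` integrable and `w q
a`, respectively `u q a`, square integrable. The price is that `q` vanishes exactly where `V = ∞`.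
-/
theorem exists_damping_weight (hm : m ≤ m0) [SigmaFinite (μ.trim hm)] {A V : X → ℝ≥0∞}
    (hA : Measurable[m] A) (hV : Measurable[m] V) (hA' : ∀ x, A x ≠ ∞) :
    ∃ q : X → ℝ≥0∞, Measurable[m] q ∧ (∀ x, q x ≤ 1) ∧ (∀ x, q x = 0 ↔ V x = ∞) ∧
      ∫⁻ x, q x * A x ∂μ ≠ ∞ ∧ ∫⁻ x, q x ^ 2 * (A x * V x) ∂μ ≠ ∞ := by
  obtain ⟨θ, θpos, θm, hθ⟩ :=
    @exists_pos_lintegral_lt_of_sigmaFinite _ m (μ.trim hm) _ 1 one_ne_zero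
  have θm' : Measurable[m] fun x => (θ x : ℝ≥0∞) := measurable_coe_nnreal_ennreal.comp θm
  rw [lintegral_trim hm θm'] at hθ
  have hle : ∀ B : ℝ≥0∞, (1 + B)⁻¹ * B ≤ 1 := fun B =>
    (mul_le_mul_right le_add_self _).trans (ENNReal.inv_mul_le_one _)
  have hinv : ∀ B : ℝ≥0∞, (1 + B)⁻¹ ≤ 1 := fun B => ENNReal.inv_le_one.2 le_self_add
  -- One factor of `q` absorbs `A`, one absorbs `V`, and `θ` supplies integrability.
  set q : X → ℝ≥0∞ := fun x => min (θ x : ℝ≥0∞) 1 * (1 + A x)⁻¹ * (1 + V x)⁻¹ with hq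
  have hqA : ∀ x, q x * A x ≤ θ x := fun x =>
    calc q x * A x = min (θ x : ℝ≥0∞) 1 * ((1 + A x)⁻¹ * A x) * (1 + V x)⁻¹ := by
          simp only [hq]; ring
      _ ≤ θ x * 1 * 1 := by
          gcongr
          · exact min_le_left _ _
          · exact hle _
          · exact hinv _
      _ = θ x := by rw [mul_one, mul_one]
  have hqV : ∀ x, q x * V x ≤ 1 := fun x =>
    calc q x * V x = min (θ x : ℝ≥0∞) 1 * (1 + A x)⁻¹ * ((1 + V x)⁻¹ * V x) := by
          simp only [hq]; ring
      _ ≤ 1 * 1 * 1 := by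
          gcongr
          · exact min_le_right _ _
          · exact hinv _
          · exact hle _
      _ = 1 := by norm_num
  refine ⟨q, ?_, fun x => ?_, fun x => ?_, ?_, ?_⟩
  · exact ((θm'.min (@measurable_const _ _ _ m 1)).mul (hA.const_add 1).inv).mul
      (hV.const_add 1).inv
  · calc q x ≤ 1 * 1 * 1 := by
          simp only [hq]
          gcongr
          · exact min_le_right _ _
          · exact hinv _
          · exact hinv _
      _ = 1 := by norm_num
  · have h1 : min (θ x : ℝ≥0∞) 1 ≠ 0 := by
      rw [← pos_iff_ne_zero]
      exact lt_min (by exact_mod_cast θpos x) one_pos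
    simp [hq, h1, hA' x]
  · exact ((lintegral_mono hqA).trans_lt (hθ.trans ENNReal.one_lt_top)).ne
  · refine ((lintegral_mono fun x => ?_).trans_lt (hθ.trans ENNReal.one_lt_top)).ne
    calc q x ^ 2 * (A x * V x) = (q x * A x) * (q x * V x) := by ring
      _ ≤ θ x * 1 := mul_le_mul' (hqA x) (hqV x)
      _ = θ x := mul_one _

/-- By `|w f| ≤ |w|² + |f|²`, where the conditional expectation of the right side is finite once `W
< ∞`. -/
theorem isConditionable_indicator_mul (hm : m ≤ m0) [SigmaFinite (μ.trim hm)]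
    (hw : AEMeasurable w μ) {f : X → ℂ} (hf : MemLp f 2 μ) :
    IsConditionable m μ fun x =>
      w x * {x | condLExp m μ (fun y => ‖w y‖ₑ ^ 2) x ≠ ∞}.indicator f x := by
  have Wm : Measurable[m] (condLExp m μ fun y => ‖w y‖ₑ ^ 2) := measurable_condLExp _ _ _
  have sm : MeasurableSet[m] {x | condLExp m μ (fun y => ‖w y‖ₑ ^ 2) x ≠ ∞} :=
    (Wm (measurableSet_singleton ∞)).compl
  have fm : AEMeasurable f μ := hf.1.aemeasurable
  refine ⟨hw.mul (fm.indicator (hm _ sm)), ?_⟩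
  set s := {x | condLExp m μ (fun y => ‖w y‖ₑ ^ 2) x ≠ ∞}
  have e : (fun x => ‖w x * s.indicator f x‖ₑ) =
      fun x => s.indicator 1 x * (‖w x‖ₑ * ‖f x‖ₑ) := by
    funext x
    by_cases hx : x ∈ s <;> simp [hx]
  have h1 := condLExp_mul_of_measurable hm
    (Measurable.indicator (@measurable_const _ _ _ m (1 : ℝ≥0∞)) sm) (hw.enorm.mul fm.enorm)
  have h2 := condLExp_mono (mΩ := m) (P := μ) (X := fun x => ‖w x‖ₑ * ‖f x‖ₑ)
    (Y := (fun x => ‖w x‖ₑ ^ 2) + fun x => ‖f x‖ₑ ^ 2) (Filter.Eventually.of_forall fun x =>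
      (le_mul_of_one_le_left' one_le_two).trans (ENNReal.two_mul_mul_le_add_sq _ _))
  have h3 := condLExp_add_left (mΩ := m) (P := μ) (fun x => ‖f x‖ₑ ^ 2) (hw.enorm.pow_const 2)
  rw [e]
  filter_upwards [h1, h2, h3, condLExp_lt_top (mΩ := m) hf.lintegral_enorm_sq_ne_top]
    with x h1 h2 h3 h4
  refine h1.trans_lt ?_
  by_cases hx : x ∈ s
  · have h5 : condLExp m μ (fun y => ‖w y‖ₑ ^ 2) x < ∞ := lt_top_iff_ne_top.2 hx
    rw [h3] at h2
    simp only [Set.indicator_of_mem hx, one_mul]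
    exact h2.trans_lt (ENNReal.add_lt_top.2 ⟨h5, h4⟩)
  · simp [hx]

/-- For `z = T* y`, cutting `y` down to `{W < ∞}` makes `w̄ y'` conditionable without changing the
pairings with `T x`. With `a = E(w̄ y')` this gives `⟨z, x⟩ = ∫ E(ux) ā` on the domain of `T`, and
the aim is `z = ū a`. Only the range matters, so `y'` may replace `y`. -/
theorem adjoint_mem_range (hm : m ≤ m0) [SigmaFinite (μ.trim hm)] (hu : AEMeasurable u μ)
    (hw : AEMeasurable w μ) (hT : Dense ((wctOperator m μ u w).domain : Set (Lp ℂ 2 μ)))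
    (y : (wctOperator m μ u w).adjoint.domain) :
    (wctOperator m μ u w).adjoint y ∈ Set.range
      (wctOperator m μ (fun x => starRingEnd ℂ (w x)) fun x => starRingEnd ℂ (u x)) := by
  set z := (wctOperator m μ u w).adjoint y with hz
  set U := condLExp m μ (fun y => ‖u y‖ₑ ^ 2) with hU
  set W := condLExp m μ (fun y => ‖w y‖ₑ ^ 2) with hW
  have Um : Measurable[m] U := measurable_condLExp _ _ _
  have Wm : Measurable[m] W := measurable_condLExp _ _ _
  set s : Set X := {x | W x ≠ ∞} with hs
  have sm : MeasurableSet[m] s := (Wm (measurableSet_singleton ∞)).compl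
  have hy' : MemLp (s.indicator y.1) 2 μ := (Lp.memLp y.1).indicator (hm _ sm)
  set y' : Lp ℂ 2 μ := hy'.toLp with hy'def
  have hwc : AEMeasurable (fun x => starRingEnd ℂ (w x)) μ :=
    Complex.continuous_conj.measurable.comp_aemeasurable hw
  have hcond0 : IsConditionable m μ fun x => starRingEnd ℂ (w x) * s.indicator y.1 x := by
    have := isConditionable_indicator_mul (m := m) (μ := μ) hm hwc (Lp.memLp y.1)
    simpa only [RCLike.enorm_conj] using this
  have hcond : IsConditionable m μ fun x => starRingEnd ℂ (w x) * y' x :=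
    hcond0.congr (by filter_upwards [hy'.coeFn_toLp] with x hx; rw [hx])
  set a := complexCondExp m μ fun x => starRingEnd ℂ (w x) * y' x with ha
  have am : Measurable[m] a := measurable_complexCondExp _
  have Am : Measurable[m] fun x => ‖a x‖ₑ ^ 2 := (measurable_enorm.comp am).pow_const 2
  -- `T x` vanishes where `E(|w|²) = ∞`, because it is square integrable.
  have hz1 : ∀ x : (wctOperator m μ u w).domain, inner ℂ z x.1 =
      ∫ t, complexCondExp m μ (fun r => u r * x.1 r) t * starRingEnd ℂ (a t) ∂μ := by
    intro x
    rw [hz, LinearPMap.adjoint_isFormalAdjoint hT y x, ← inner_wctOperator hm x y' hcond,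
      L2.inner_def, L2.inner_def]
    have hfin : ∀ᵐ t ∂μ, ‖complexCondExp m μ (fun r => u r * x.1 r) t‖ₑ ^ 2 * W t < ∞ := by
      refine ae_lt_top ((((measurable_enorm.comp (measurable_complexCondExp _)).pow_const 2).mul
        Wm).mono hm le_rfl) ?_
      have := x.2.2.lintegral_enorm_sq_ne_top
      rwa [lintegral_enorm_mul_sq hm hw (measurable_complexCondExp _)] at this
    refine integral_congr_ae ?_
    filter_upwards [hfin, coeFn_wctOperator x, hy'.coeFn_toLp] with t h1 h2 h3
    by_cases ht : t ∈ s
    · rw [h3, Set.indicator_of_mem ht]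
    · have hWt : W t = ∞ := not_not.1 ht
      have : complexCondExp m μ (fun r => u r * x.1 r) t = 0 := by
        by_contra hne
        simp [hWt, ENNReal.mul_top, hne] at h1
      rw [h2, this]
      simp
  -- The test function used below is damped to `0` on `{W = ∞}` and detects nothing there, so this
  -- set is treated separately: `y'` vanishes on it.
  have ha_s : ∀ᵐ t ∂μ, W t = ∞ → a t = 0 := by
    have hc : Measurable[m] (s.indicator (1 : X → ℂ)) :=
      Measurable.indicator (@measurable_const _ _ _ m (1 : ℂ)) sm
    have e : (fun t => s.indicator (1 : X → ℂ) t * (starRingEnd ℂ (w t) * y' t)) =ᵐ[μ]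
        fun t => starRingEnd ℂ (w t) * y' t := by
      filter_upwards [hy'.coeFn_toLp] with t ht
      rw [ht]
      by_cases h : t ∈ s <;> simp [h]
    filter_upwards [complexCondExp_congr (m := m) e,
      complexCondExp_mul_of_measurable hm hc hcond] with t h1 h2 h3
    have : t ∉ s := fun h => h h3
    rw [h1, Set.indicator_of_notMem this, zero_mul] at h2
    exact h2
  -- `a` vanishes where `E(|u|²) = ∞`, by solving `E(uf) = a` there with `f` arbitrarily small.
  set N : Set X := {x | U x = ∞} with hN
  have Nm : MeasurableSet[m] N := Um (measurableSet_singleton ∞)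
  have ha_N : ∀ᵐ t ∂μ, U t = ∞ → a t = 0 := by
    obtain ⟨q, qm, q1, q0, qA, qW⟩ := exists_damping_weight (μ := μ) hm Am Wm
      (fun x => by finiteness)
    have q1' : ∀ t, q t ≠ ∞ := fun t => ((q1 t).trans_lt ENNReal.one_lt_top).ne
    set g : X → ℂ := N.indicator fun t => ((q t).toReal : ℂ) * a t with hg
    have gm : Measurable[m] g :=
      ((Complex.measurable_ofReal.comp qm.ennreal_toReal).mul am).indicator Nm
    have gen : ∀ t, ‖g t‖ₑ ≤ q t * ‖a t‖ₑ := by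
      intro t
      by_cases ht : t ∈ N
      · rw [hg, Set.indicator_of_mem ht, enorm_mul, ← ofReal_norm ((q t).toReal : ℂ),
          Complex.norm_real, Real.norm_of_nonneg ENNReal.toReal_nonneg,
          ENNReal.ofReal_toReal (q1' t)]
      · simp [hg, ht]
    have gU : ∫⁻ t, ‖g t‖ₑ ^ 2 * (U t)⁻¹ ∂μ = 0 := by
      rw [lintegral_congr (g := fun _ => 0), lintegral_zero]
      intro t
      by_cases ht : t ∈ N
      · have : U t = ∞ := ht
        simp [this]
      · simp [hg, ht]
    have hwg : MemLp (fun t => w t * g t) 2 μ := by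
      rw [memLp_two_iff_lintegral_enorm_sq (f := fun t => w t * g t)
        (hw.mul (gm.mono hm le_rfl).aemeasurable).aestronglyMeasurable,
        lintegral_enorm_mul_sq hm hw gm]
      refine ((lintegral_mono fun t => ?_).trans_lt qW.lt_top).ne
      calc ‖g t‖ₑ ^ 2 * W t ≤ (q t * ‖a t‖ₑ) ^ 2 * W t := by gcongr; exact gen t
        _ = q t ^ 2 * (‖a t‖ₑ ^ 2 * W t) := by ring
    have hbound : ∀ δ : ℝ, 0 < δ → ‖∫ t, g t * starRingEnd ℂ (a t) ∂μ‖ ≤ ‖z‖ * δ := by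
      intro δ hδ
      obtain ⟨f, hf, huf, hfg, hfn⟩ := exists_complexCondExp_mul_eq hm hu gm
        (gU.trans_ne ENNReal.zero_ne_top) (ε := ENNReal.ofReal (δ ^ 2))
        (ENNReal.ofReal_pos.2 (by positivity)).ne' ENNReal.ofReal_ne_top
      rw [gU, zero_add] at hfn
      obtain ⟨hd, -⟩ := toLp_mem_domain hf huf hfg hwg
      have h1 := hz1 ⟨hf.toLp, hd⟩
      have h2 : ∫ t, complexCondExp m μ (fun r => u r * hf.toLp f r) t * starRingEnd ℂ (a t) ∂μ =
          ∫ t, g t * starRingEnd ℂ (a t) ∂μ := by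
        refine integral_congr_ae ?_
        filter_upwards [complexCondExp_mul_toLp (m := m) (u := u) hf, hfg] with t h1 h2
        rw [h1, h2]
      rw [← h2, ← h1]
      refine (norm_inner_le_norm _ _).trans ?_
      gcongr
      exact norm_toLp_le hf hδ.le hfn
    have hzero : ∫ t, g t * starRingEnd ℂ (a t) ∂μ = 0 := by
      by_contra hne
      have hpos := norm_pos_iff.2 hne
      -- This `δ` makes `‖z‖ δ` strictly smaller than the norm of the integral.
      have h1 := hbound (‖∫ t, g t * starRingEnd ℂ (a t) ∂μ‖ / (2 * (‖z‖ + 1))) (by positivity)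
      have h2 : ‖z‖ * (‖∫ t, g t * starRingEnd ℂ (a t) ∂μ‖ / (2 * (‖z‖ + 1))) <
          ‖∫ t, g t * starRingEnd ℂ (a t) ∂μ‖ := by
        rw [mul_div_assoc', div_lt_iff₀ (by positivity)]
        nlinarith [norm_nonneg z]
      exact absurd h1 (not_le.2 h2)
    have hreal : ∀ t, g t * starRingEnd ℂ (a t) =
        ((N.indicator (fun t => (q t).toReal * ‖a t‖ ^ 2) t : ℝ) : ℂ) := by
      intro t
      by_cases ht : t ∈ N
      · rw [hg, Set.indicator_of_mem ht, Set.indicator_of_mem ht, mul_assoc, Complex.mul_conj']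
        push_cast
        ring
      · simp [hg, ht]
    simp only [hreal] at hzero
    rw [integral_complex_ofReal, Complex.ofReal_eq_zero, integral_eq_zero_iff_of_nonneg] at hzero
    · filter_upwards [hzero, ha_s] with t h1 h2 h3
      have ht : t ∈ N := h3
      rw [Set.indicator_of_mem ht, Pi.zero_apply, mul_eq_zero, ENNReal.toReal_eq_zero_iff, q0] at h1
      rcases h1 with (h1 | h1) | h1
      · exact h2 h1
      · exact absurd h1 (q1' t)
      · simpa using h1
    · intro t
      exact Set.indicator_nonneg (fun t _ => by positivity) t
    · refine Integrable.indicator ?_ (hm _ Nm)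
      refine ⟨((qm.ennreal_toReal.mul ((measurable_norm.comp am).pow_const 2)).mono hm
        le_rfl).aestronglyMeasurable, ?_⟩
      refine (lintegral_mono fun t => ?_).trans_lt qA.lt_top
      rw [← ofReal_norm, Real.norm_of_nonneg (by positivity),
        ENNReal.ofReal_mul ENNReal.toReal_nonneg, ENNReal.ofReal_toReal (q1' t),
        ENNReal.ofReal_pow (norm_nonneg _), ofReal_norm]
  -- hence `z = conj u * a`, by testing against a dense set.
  have hza : z =ᵐ[μ] fun t => starRingEnd ℂ (u t) * a t := by
    obtain ⟨q, qm, q1, q0, -, qU⟩ := exists_damping_weight (μ := μ) hm Am Um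
      (fun x => by finiteness)
    have q1' : ∀ t, q t ≠ ∞ := fun t => ((q1 t).trans_lt ENNReal.one_lt_top).ne
    set c : X → ℂ := fun t => ((q t).toReal : ℂ) with hc
    have cm : Measurable[m] c := Complex.measurable_ofReal.comp qm.ennreal_toReal
    have cen : ∀ t, ‖c t‖ₑ = q t := fun t => by
      rw [hc, ← ofReal_norm ((q t).toReal : ℂ), Complex.norm_real,
        Real.norm_of_nonneg ENNReal.toReal_nonneg, ENNReal.ofReal_toReal (q1' t)]
    have cconj : ∀ t, starRingEnd ℂ (c t) = c t := fun t => Complex.conj_ofReal _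
    -- `c` vanishes on `N = {U = ∞}`, which would erase `z` there. Replacing it by `1` on `N` is
    -- harmless on the other side of the pairing, since `a = 0` on `N`, and it yields `z = 0` on
    -- `N`.
    set c' : X → ℂ := N.piecewise 1 c with hc'
    have c'm : Measurable[m] c' := by
      refine Measurable.piecewise Nm ?_ cm
      exact @measurable_const _ _ _ m 1
    have c'conj : ∀ t, starRingEnd ℂ (c' t) = c' t := fun t => by
      by_cases ht : t ∈ N <;> simp [hc', ht, cconj]
    have c'1 : ∀ t, ‖c' t‖ ≤ 1 := fun t => by
      by_cases ht : t ∈ N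
      · simp [hc', ht]
      · rw [hc', Set.piecewise_eq_of_notMem _ _ _ ht, hc, Complex.norm_real,
          Real.norm_of_nonneg ENNReal.toReal_nonneg]
        exact ENNReal.toReal_mono ENNReal.one_ne_top (q1 t)
    have hmem1 : MemLp (fun t => c' t * z t) 2 μ :=
      (Lp.memLp z).of_le ((c'm.mono hm le_rfl).aestronglyMeasurable.mul (Lp.memLp z).1)
        (Filter.Eventually.of_forall fun t => by
          rw [norm_mul]; exact mul_le_of_le_one_left (norm_nonneg _) (c'1 t))
    have hmem2' : MemLp (fun t => u t * (c t * starRingEnd ℂ (a t))) 2 μ := by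
      have hb : Measurable[m] fun t => c t * starRingEnd ℂ (a t) :=
        cm.mul (measurable_conj_comp am)
      rw [memLp_two_iff_lintegral_enorm_sq (f := fun t => u t * (c t * starRingEnd ℂ (a t)))
        (hu.mul (hb.mono hm le_rfl).aemeasurable).aestronglyMeasurable,
        lintegral_enorm_mul_sq hm hu hb]
      convert qU using 3 with t
      rw [enorm_mul, cen, RCLike.enorm_conj, mul_pow, mul_assoc]
    have hmem2 : MemLp (fun t => c t * (starRingEnd ℂ (u t) * a t)) 2 μ := by
      have e : (fun t => c t * (starRingEnd ℂ (u t) * a t)) =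
          fun t => starRingEnd ℂ (u t * (c t * starRingEnd ℂ (a t))) := by
        funext t
        rw [map_mul, map_mul, Complex.conj_conj, cconj]
        ring
      rw [e]
      exact hmem2'.star
    -- Both sides have the same inner product with every `x` in the dense domain: `c'` is moved onto
    -- `x`, which keeps it in the domain, and `E` is then removed from `E(ux)` against `c ā`, the
    -- damping making the integrand integrable.
    have heq : hmem1.toLp = hmem2.toLp := by
      refine hT.eq_of_inner_left ℂ fun x hx => ?_
      obtain ⟨hcx, hcd, hcE⟩ := mul_mem_domain hm ⟨x, hx⟩ c'm c'1
      have h1 := hz1 ⟨hcx.toLp, hcd⟩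
      have e1 : inner ℂ hmem1.toLp x = inner ℂ z hcx.toLp := by
        rw [L2.inner_def, L2.inner_def]
        refine integral_congr_ae ?_
        filter_upwards [hmem1.coeFn_toLp, hcx.coeFn_toLp] with t h1 h2
        rw [h1, h2, RCLike.inner_apply, RCLike.inner_apply, map_mul, c'conj]
        ring
      have e2 : ∫ t, complexCondExp m μ (fun r => u r * hcx.toLp _ r) t *
          starRingEnd ℂ (a t) ∂μ = ∫ t, (c t * starRingEnd ℂ (a t)) *
            complexCondExp m μ (fun r => u r * x r) t ∂μ := by
        refine integral_congr_ae ?_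
        filter_upwards [hcE, ha_N] with t h1 h2
        rw [h1]
        by_cases ht : t ∈ N
        · simp [h2 ht]
        · rw [hc', Set.piecewise_eq_of_notMem _ _ _ ht]
          ring
      have hint : Integrable (fun t => (c t * starRingEnd ℂ (a t)) * (u t * x t)) μ := by
        refine (hmem2'.integrable_mul (Lp.memLp x)).congr (Filter.Eventually.of_forall fun t => ?_)
        simp only [Pi.mul_apply]
        ring
      rw [e1, h1, e2, integral_mul_complexCondExp (a := fun t => c t * starRingEnd ℂ (a t)) hm
        (cm.mul (measurable_conj_comp am)) hx.1 hint, L2.inner_def]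
      refine integral_congr_ae ?_
      filter_upwards [hmem2.coeFn_toLp] with t ht
      rw [ht, RCLike.inner_apply]
      simp only [map_mul, Complex.conj_conj, cconj]
      ring
    have hae : (fun t => c' t * z t) =ᵐ[μ] fun t => c t * (starRingEnd ℂ (u t) * a t) :=
      hmem1.coeFn_toLp.symm.trans ((by rw [heq] : _ =ᵐ[μ] _).trans hmem2.coeFn_toLp)
    filter_upwards [hae, ha_N] with t h1 h2
    by_cases ht : t ∈ N
    · rw [h2 ht, hc', Set.piecewise_eq_of_mem _ _ _ ht] at h1
      rw [h2 ht]
      simpa using h1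
    · rw [hc', Set.piecewise_eq_of_notMem _ _ _ ht] at h1
      have hct : c t ≠ 0 := by
        rw [← enorm_ne_zero, cen, Ne, q0]
        exact ht
      exact mul_left_cancel₀ hct h1
  exact ⟨⟨y', hcond, (Lp.memLp z).ae_eq hza⟩, Lp.ext ((coeFn_wctOperator _).trans hza.symm)⟩

/-- The inclusion not covered by `adjoint_mem_range` is formal adjointness: `T*` extends every
formal adjoint of the densely defined `T`. -/
theorem range_adjoint_wctOperator (hm : m ≤ m0) [SigmaFinite (μ.trim hm)] (hu : AEMeasurable u μ)
    (hw : AEMeasurable w μ) (hT : Dense ((wctOperator m μ u w).domain : Set (Lp ℂ 2 μ))) :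
    Set.range (wctOperator m μ u w).adjoint = Set.range
      (wctOperator m μ (fun x => starRingEnd ℂ (w x)) fun x => starRingEnd ℂ (u x)) := by
  refine Set.Subset.antisymm ?_ ?_
  · rintro _ ⟨y, rfl⟩
    exact adjoint_mem_range hm hu hw hT y
  · rintro _ ⟨y, rfl⟩
    have h := LinearPMap.IsFormalAdjoint.le_adjoint hT
      (isFormalAdjoint_wctOperator (u := u) (w := w) (μ := μ) hm)
    exact ⟨⟨y.1, h.1 y.2⟩, (h.2 rfl).symm⟩

end WCTaux

/-! ### The equivalence -/

theorem corollary2p10 {X : Type*} {m m0 : MeasurableSpace X} (hm : m ≤ m0) (μ : Measure X)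
    [SigmaFinite μ] [SigmaFinite (μ.trim hm)] (u w : X → ℂ)
    (hu : IsConditionable m μ u) (hw : IsConditionable m μ w)
    (hT : Dense ((wctOperator m μ u w).domain : Set (Lp ℂ 2 μ))) :
    (IsClosed (Set.range (wctOperator m μ u w)) ↔
        IsClosed (Set.range (wctOperator m μ u w).adjoint)) ∧
      (IsClosed (Set.range (wctOperator m μ u w)) ↔
        ∃ r : ℝ, 0 < r ∧ ∀ᵐ x ∂μ,
          condLExp m μ (fun y => ‖u y‖ₑ ^ 2) x ≠ 0 → condLExp m μ (fun y => ‖w y‖ₑ ^ 2) x ≠ 0 →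
            ENNReal.ofReal r ≤
              condLExp m μ (fun y => ‖u y‖ₑ ^ 2) x * condLExp m μ (fun y => ‖w y‖ₑ ^ 2) x) := by
  have h := WCTaux.isClosed_range_wctOperator_iff hm hu.1 hw.1
  refine ⟨?_, h⟩
  -- The closed-range criterion for the pair `(w̄, ū)` is the one for `(u, w)` with the two factors
  -- exchanged.
  rw [WCTaux.range_adjoint_wctOperator hm hu.1 hw.1 hT, h,
    WCTaux.isClosed_range_wctOperator_iff hm hw.conj.1 hu.conj.1]
  simp only [RCLike.enorm_conj]
  refine exists_congr fun r => and_congr_right fun _ => Filter.eventually_congr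
    (Filter.Eventually.of_forall fun x => ?_)
  rw [mul_comm]
  exact ⟨fun h h1 h2 => h h2 h1, fun h h1 h2 => h h2 h1⟩
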